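/- Let $\mathbf{FHilb}$ be the category of finite-dimensional complex Hilbert spaces and linear maps, with its usual dagger compact structure: tensor product $\otimes$ with unit $\mathbb{C}$, symmetry $h\otimes k\mapsto k\otimes h$, dagger given by adjoints, dual Hilbert spaces $H^*$, $\varepsilon_H\colon H\otimes H^*\to\mathbb{C}$, $\varepsilon_H(h\otimes\xi)=\xi(h)$, and $\eta_H\colon\mathbb{C}\to H^*\otimes H$, $\eta_H(1)=\sum_i\overline{e_i}\otimes e_i$ for any orthonormal basis $(e_i)$ of $H$, where $\overline{e_i}=\langle e_i,\cdot\rangle$. Associativity and unit isomorphisms are suppressed below. A normalisable dagger Frobenius algebra in $\mathbf{FHilb}$ is an object $A$ with maps $\mu_A\colon A\otimes A\to A$ and $u_A\colon\mathbb{C}\to A$ that are associative and unital, satisfy the Frobenius law $(\mu_A\otimes 1)(1\otimes\mu_A^\dagger)=\mu_A^\dagger\mu_A=(1\otimes\mu_A)(\mu_A^\dagger\otimes 1)$, and for which there is a positive invertible map $z\colon A\to A$ that is central, i.e. $\mu_A(z\otimes 1)=z\mu_A=\mu_A(1\otimes z)$, and satisfies $\mathrm{Tr}_A(\mu_A)\circ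 z^2=u_A^\dagger$, where $\mathrm{Tr}_A(\mu_A)\colon A\to\mathbb{C}$ is the partial trace of $\mu_A$ over its second input and its output. For such $A$ let $a_A=(1_{A^*}\otimes\mu_A)(\eta_A\otimes 1_A)\colon A\to A^*\otimes A$. A linear map $f\colon A\to B$ between such algebras satisfies the CP*-condition when there are an object $X$ and a map $g\colon A\to X\otimes B$ with $$a_B\circ f\circ a_A^\dagger=(1_{B^*}\otimes\eta_X^\dagger\otimes 1_B)\circ(g_*\otimes g)\colon A^*\otimes A\to B^*\otimes B,$$ where $g_*=(g^\dagger)^*\colon A^*\to B^*\otimes X^*$ is the conjugate of $g$. Then the linear maps satisfying the CP*-condition include all identities and are closed under composition, so that they form a category $\mathrm{CP}^*[\mathbf{FHilb}]$ whose objects are the normalisable dagger Frobenius algebras in $\mathbf{FHilb}$. This category is equivalent to the category whose objects are the finite-dimensional (complex, unital) C*-algebras and whose morphisms are the completely positive linear maps, i.e. the linear maps $f\colon A\to B$ such that $f\otimes\mathrm{id}\colon A\otimes\mathbb{M}_n\to B\otimes\mathbb{M}_n$ sends elements of the form $b^\star b$ to elements of the form $c^\star c$ for every natural number $n$. -/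

import Mathlib

open CategoryTheory MonoidalCategory
open scoped TensorProduct

noncomputable section

universe v u

/-! ### Dagger categories and dagger compact categories -/

/-- A dagger on a category: an involutive, identity-on-objects, contravariant functor. -/
class DaggerCategory (V : Type u) [Category.{v} V] where
  dagger : ∀ {X Y : V}, (X ⟶ Y) → (Y ⟶ X)
  dagger_id : ∀ X : V, dagger (𝟙 X) = 𝟙 X
  dagger_comp : ∀ {X Y Z : V} (f : X ⟶ Y) (g : Y ⟶ Z), dagger (f ≫ g) = dagger g ≫ dagger f
  dagger_dagger : ∀ {X Y : V} (f : X ⟶ Y), dagger (dagger f) = f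

open DaggerCategory

/-- A dagger compact category. The dual of `A` is the left dual `A^*` with its unit
`η_A : I ⟶ A^* ⊗ A` and counit `ε_A : A ⊗ A^* ⟶ I`. The dagger is monoidal, the coherence
isomorphisms are unitary, and `η_A` is `(ε_A)†` followed by the symmetry. -/
class DaggerCompactCategory (V : Type u) [Category.{v} V] [MonoidalCategory V]
    [SymmetricCategory V] [LeftRigidCategory V] extends DaggerCategory V where
  dagger_tensorHom : ∀ {X Y X' Y' : V} (f : X ⟶ Y) (g : X' ⟶ Y'),
    dagger (f ⊗ₘ g) = dagger f ⊗ₘ dagger g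
  dagger_associator : ∀ X Y Z : V, dagger (α_ X Y Z).hom = (α_ X Y Z).inv
  dagger_leftUnitor : ∀ X : V, dagger (λ_ X).hom = (λ_ X).inv
  dagger_rightUnitor : ∀ X : V, dagger (ρ_ X).hom = (ρ_ X).inv
  dagger_braiding : ∀ X Y : V, dagger (β_ X Y).hom = (β_ X Y).inv
  dagger_evaluation : ∀ X : V,
    dagger (ExactPairing.evaluation (HasLeftDual.leftDual X) X) ≫
      (β_ X (HasLeftDual.leftDual X)).hom =
    ExactPairing.coevaluation (HasLeftDual.leftDual X) X

/-! ### Abstract C*-algebras and the CP*-construction -/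

namespace CPStarConstruction

section General

variable {V : Type u} [Category.{v} V] [MonoidalCategory V] [SymmetricCategory V]
  [LeftRigidCategory V] [DaggerCompactCategory V]

/-- The chosen dual `A^*`. -/
abbrev dual (A : V) : V := HasLeftDual.leftDual A

/-- The cup `η_A : I ⟶ A^* ⊗ A`. -/
abbrev cup (A : V) : 𝟙_ V ⟶ dual A ⊗ A := ExactPairing.coevaluation (dual A) A

/-- The cap `ε_A : A ⊗ A^* ⟶ I`. -/
abbrev cap (A : V) : A ⊗ dual A ⟶ 𝟙_ V := ExactPairing.evaluation (dual A) A

/-- A morphism `g : A ⟶ A` is positive when `g = h† ∘ h` for some `h`. -/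
def IsPositive {A : V} (g : A ⟶ A) : Prop :=
  ∃ (B : V) (h : A ⟶ B), g = h ≫ dagger h

/-- A positive isomorphism. -/
def IsPositiveDefinite {A : V} (g : A ⟶ A) : Prop :=
  IsPositive g ∧ IsIso g

/-- A morphism `z : A ⟶ A` is central for the multiplication `mul`. -/
def IsCentral {A : V} (mul : A ⊗ A ⟶ A) (z : A ⟶ A) : Prop :=
  z ▷ A ≫ mul = mul ≫ z ∧ A ◁ z ≫ mul = mul ≫ z

/-- The partial trace `Tr_A(mul) : A ⟶ I` of a multiplication `A ⊗ A ⟶ A`, closing the second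
input and the output into a loop. -/
def mulTrace {A : V} (mul : A ⊗ A ⟶ A) : A ⟶ 𝟙_ V :=
  (ρ_ A).inv ≫ A ◁ dagger (cap A) ≫ (α_ A A (dual A)).inv ≫ mul ▷ dual A ≫ cap A

variable (V) in
/-- A normalisable dagger Frobenius algebra in `V`. The comultiplication and the counit are the
daggers of the multiplication and the unit. -/
structure NormalisableAlgebra where
  carrier : V
  mul : carrier ⊗ carrier ⟶ carrier
  unit : 𝟙_ V ⟶ carrier
  mul_assoc : mul ▷ carrier ≫ mul = (α_ carrier carrier carrier).hom ≫ carrier ◁ mul ≫ mul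
  unit_mul : unit ▷ carrier ≫ mul = (λ_ carrier).hom
  mul_unit : carrier ◁ unit ≫ mul = (ρ_ carrier).hom
  frobenius_left :
    carrier ◁ dagger mul ≫ (α_ carrier carrier carrier).inv ≫ mul ▷ carrier = mul ≫ dagger mul
  frobenius_right :
    dagger mul ▷ carrier ≫ (α_ carrier carrier carrier).hom ≫ carrier ◁ mul = mul ≫ dagger mul
  normalisable : ∃ z : carrier ⟶ carrier,
    IsCentral mul z ∧ IsPositiveDefinite z ∧ z ≫ z ≫ mulTrace mul = dagger unit

/-- All morphisms of `V` between the underlying objects. -/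
instance : Category (NormalisableAlgebra V) where
  Hom A B := A.carrier ⟶ B.carrier
  id A := 𝟙 A.carrier
  comp f g := f ≫ g

/-- The action `A ⟶ A^* ⊗ A`: the multiplication with its left input bent upwards. -/
def NormalisableAlgebra.action (A : NormalisableAlgebra V) :
    A.carrier ⟶ dual A.carrier ⊗ A.carrier :=
  (λ_ A.carrier).inv ≫ cup A.carrier ▷ A.carrier ≫
    (α_ (dual A.carrier) A.carrier A.carrier).hom ≫ dual A.carrier ◁ A.mul

/-- The coaction `A^* ⊗ A ⟶ A`: the comultiplication with its left output bent downwards. -/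
def NormalisableAlgebra.coaction (A : NormalisableAlgebra V) :
    dual A.carrier ⊗ A.carrier ⟶ A.carrier :=
  dual A.carrier ◁ dagger A.mul ≫ (α_ (dual A.carrier) A.carrier A.carrier).inv ≫
    dagger (cup A.carrier) ▷ A.carrier ≫ (λ_ A.carrier).hom

/-- For `g : A ⟶ X ⊗ B`, the conjugate `g_* = (g†)^* : A^* ⟶ B^* ⊗ X^*`, where the dual of
`X ⊗ B` is realised as `B^* ⊗ X^*` with nested cups and caps. -/
def conj {A B X : V} (g : A ⟶ X ⊗ B) : dual A ⟶ dual B ⊗ dual X :=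
  letI : HasLeftDual (X ⊗ B) := hasLeftDualTensor
  leftAdjointMate (dagger g)

/-- The doubled morphism `A^* ⊗ A ⟶ B^* ⊗ B` with Kraus map `g : A ⟶ X ⊗ B`:
the morphism `g_* ⊗ g` with its outputs `X^*` and `X` joined by a cap. -/
def doubled {A B X : V} (g : A ⟶ X ⊗ B) : dual A ⊗ A ⟶ dual B ⊗ B :=
  (conj g ⊗ₘ g) ≫ (α_ (dual B) (dual X) (X ⊗ B)).hom ≫
    dual B ◁ ((α_ (dual X) X B).inv ≫ dagger (cup X) ▷ B ≫ (λ_ B).hom)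

variable (V) in
/-- The CP*-condition on a morphism `f : A ⟶ B` between normalisable dagger Frobenius algebras. -/
def cpStarCondition : MorphismProperty (NormalisableAlgebra V) := fun A B f =>
  ∃ (X : V) (g : A.carrier ⟶ X ⊗ B.carrier),
    A.coaction ≫ (show A.carrier ⟶ B.carrier from f) ≫ B.action = doubled g

variable (V) in
/-- The category `CP*[V]`: normalisable dagger Frobenius algebras and the morphisms satisfying
the CP*-condition, with the composition and identities of `V`. It is a category once these
morphisms contain the identities and are closed under composition. -/
abbrev CPStar [(cpStarCondition V).IsMultiplicative] := WideSubcategory (cpStarCondition V)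

end General

end CPStarConstruction

/-! ### Finite-dimensional Hilbert spaces -/

/-- Finite-dimensional complex Hilbert spaces. -/
structure FHilb where
  carrier : Type
  [normedAddCommGroup : NormedAddCommGroup carrier]
  [innerProductSpace : InnerProductSpace ℂ carrier]
  [finiteDimensional : FiniteDimensional ℂ carrier]

namespace FHilb

instance : CoeSort FHilb Type := ⟨FHilb.carrier⟩

attribute [instance] normedAddCommGroup innerProductSpace finiteDimensional

/-- Morphisms of `FHilb` are linear maps. -/
@[ext]
structure Hom (H K : FHilb) where
  lin : H →ₗ[ℂ] K

instance : Category FHilb where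
  Hom H K := Hom H K
  id _ := ⟨LinearMap.id⟩
  comp f g := ⟨g.lin ∘ₗ f.lin⟩

@[ext]
theorem hom_ext {H K : FHilb} {f g : H ⟶ K} (h : f.lin = g.lin) : f = g := Hom.ext h

@[simp] theorem id_lin (H : FHilb) : Hom.lin (𝟙 H) = LinearMap.id := rfl

@[simp] theorem comp_lin {H K L : FHilb} (f : H ⟶ K) (g : K ⟶ L) :
    (f ≫ g).lin = g.lin ∘ₗ f.lin := rfl

/-- A linear equivalence as an isomorphism of `FHilb`. -/
def isoOfEquiv {H K : FHilb} (e : H ≃ₗ[ℂ] K) : H ≅ K where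
  hom := ⟨e.toLinearMap⟩
  inv := ⟨e.symm.toLinearMap⟩
  hom_inv_id := by ext; simp
  inv_hom_id := by ext; simp

/-- The usual tensor product of Hilbert spaces, with unit `ℂ`. -/
instance : MonoidalCategoryStruct FHilb where
  tensorObj H K := ⟨H ⊗[ℂ] K⟩
  tensorUnit := ⟨ℂ⟩
  tensorHom f g := ⟨TensorProduct.map f.lin g.lin⟩
  whiskerLeft _ _ _ f := ⟨TensorProduct.map LinearMap.id f.lin⟩
  whiskerRight f _ := ⟨TensorProduct.map f.lin LinearMap.id⟩
  associator H K L := isoOfEquiv (TensorProduct.assoc ℂ H K L)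
  leftUnitor H := isoOfEquiv (TensorProduct.lid ℂ H)
  rightUnitor H := isoOfEquiv (TensorProduct.rid ℂ H)

@[simp] theorem tensorHom_lin {H K H' K' : FHilb} (f : H ⟶ K) (g : H' ⟶ K') :
    (f ⊗ₘ g).lin = TensorProduct.map f.lin g.lin := rfl

@[simp] theorem whiskerLeft_lin (H : FHilb) {K L : FHilb} (f : K ⟶ L) :
    (H ◁ f).lin = TensorProduct.map LinearMap.id f.lin := rfl

@[simp] theorem whiskerRight_lin {K L : FHilb} (f : K ⟶ L) (H : FHilb) :
    (f ▷ H).lin = TensorProduct.map f.lin LinearMap.id := rfl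

@[simp] theorem associator_hom_lin (H K L : FHilb) :
    (α_ H K L).hom.lin = (TensorProduct.assoc ℂ H K L).toLinearMap := rfl

@[simp] theorem associator_inv_lin (H K L : FHilb) :
    (α_ H K L).inv.lin = (TensorProduct.assoc ℂ H K L).symm.toLinearMap := rfl

@[simp] theorem leftUnitor_hom_lin (H : FHilb) :
    (λ_ H).hom.lin = (TensorProduct.lid ℂ H).toLinearMap := rfl

@[simp] theorem leftUnitor_inv_lin (H : FHilb) :
    (λ_ H).inv.lin = (TensorProduct.lid ℂ H).symm.toLinearMap := rfl

@[simp] theorem rightUnitor_hom_lin (H : FHilb) :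
    (ρ_ H).hom.lin = (TensorProduct.rid ℂ H).toLinearMap := rfl

@[simp] theorem rightUnitor_inv_lin (H : FHilb) :
    (ρ_ H).inv.lin = (TensorProduct.rid ℂ H).symm.toLinearMap := rfl

instance : MonoidalCategory FHilb := MonoidalCategory.ofTensorHom
  (id_tensorHom_id := fun _ _ => hom_ext TensorProduct.map_id)
  (tensorHom_comp_tensorHom := fun _ _ _ _ => hom_ext (TensorProduct.map_comp _ _ _ _).symm)
  (associator_naturality := fun _ _ _ =>
    hom_ext (TensorProduct.ext_threefold fun _ _ _ => rfl))
  (leftUnitor_naturality := fun f =>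
    hom_ext (TensorProduct.ext' fun x y => (f.lin.map_smul (show ℂ from x) y).symm))
  (rightUnitor_naturality := fun f =>
    hom_ext (TensorProduct.ext' fun x y => (f.lin.map_smul (show ℂ from y) x).symm))
  (pentagon := fun _ _ _ _ => hom_ext (TensorProduct.ext_fourfold fun _ _ _ _ => rfl))
  (triangle := fun _ _ => hom_ext (TensorProduct.ext_threefold fun x y z =>
    TensorProduct.tmul_smul (R := ℂ) (show ℂ from y) x z))
  (id_tensorHom := fun _ _ _ _ => rfl)
  (tensorHom_id := fun _ _ => rfl)

/-- The symmetry `h ⊗ k ↦ k ⊗ h`. -/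
instance : BraidedCategory FHilb where
  braiding H K := isoOfEquiv (TensorProduct.comm ℂ H K)
  braiding_naturality_left _ _ := hom_ext (TensorProduct.ext' fun _ _ => rfl)
  braiding_naturality_right _ _ _ _ := hom_ext (TensorProduct.ext' fun _ _ => rfl)
  hexagon_forward _ _ _ := hom_ext (TensorProduct.ext_threefold fun _ _ _ => rfl)
  hexagon_reverse _ _ _ := hom_ext (by
    apply TensorProduct.ext; ext x : 1; apply TensorProduct.ext'; intro y z; rfl)

@[simp] theorem braiding_hom_lin (H K : FHilb) :
    (β_ H K).hom.lin = (TensorProduct.comm ℂ H K).toLinearMap := rfl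

@[simp] theorem braiding_inv_lin (H K : FHilb) :
    (β_ H K).inv.lin = (TensorProduct.comm ℂ H K).symm.toLinearMap := rfl

instance : SymmetricCategory FHilb where
  symmetry _ _ := hom_ext (TensorProduct.ext' fun _ _ => rfl)

/-- The dual Hilbert space, `⟪ξ, ζ⟫ = ⟪z, x⟫` where `ξ = ⟪x, ·⟫` and `ζ = ⟪z, ·⟫`. -/
abbrev dualInnerProductSpace (H : Type) [NormedAddCommGroup H] [InnerProductSpace ℂ H]
    [FiniteDimensional ℂ H] : InnerProductSpace ℂ (StrongDual ℂ H) where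
  inner ξ ζ := inner ℂ ((InnerProductSpace.toDual ℂ H).symm ζ)
    ((InnerProductSpace.toDual ℂ H).symm ξ)
  norm_sq_eq_re_inner ξ := by
    rw [← norm_sq_eq_re_inner, LinearIsometryEquiv.norm_map]
  conj_inner_symm ξ ζ := inner_conj_symm _ _
  add_left ξ ζ τ := by rw [map_add, inner_add_right]
  smul_left ξ ζ r := by rw [map_smulₛₗ, inner_smul_right]

/-- The dual Hilbert space of `H`, as an object of `FHilb`. -/
def dual (H : FHilb) : FHilb where
  carrier := StrongDual ℂ H
  innerProductSpace := dualInnerProductSpace H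
  finiteDimensional := inferInstanceAs (FiniteDimensional ℂ (StrongDual ℂ H))

/-- An element of the dual Hilbert space as a functional on `H`. -/
def functional {H : FHilb} (ξ : dual H) : StrongDual ℂ H := ξ

/-- The linear functional `ē = ⟪e, ·⟫`. -/
def bar {H : FHilb} (e : H) : dual H := InnerProductSpace.toDual ℂ H e

/-- `η_H(1) = ∑ᵢ ēᵢ ⊗ eᵢ` for an orthonormal basis `e`. -/
def cupVector (H : FHilb) : dual H ⊗[ℂ] H :=
  ∑ i, bar (stdOrthonormalBasis ℂ H i) ⊗ₜ[ℂ] stdOrthonormalBasis ℂ H i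

/-- `ε_H(h ⊗ ξ) = ξ(h)`. -/
def capMap (H : FHilb) : H ⊗[ℂ] dual H →ₗ[ℂ] ℂ :=
  TensorProduct.lift (LinearMap.flip
    (ContinuousLinearMap.coeLM ℂ : StrongDual ℂ H →ₗ[ℂ] H →ₗ[ℂ] ℂ))

theorem capMap_tmul (H : FHilb) (h : H) (ξ : dual H) :
    capMap H (h ⊗ₜ ξ) = functional ξ h := rfl

theorem capMap_bar (H : FHilb) (h e : H) : capMap H (h ⊗ₜ bar e) = inner ℂ e h := rfl

theorem sum_inner_smul (H : FHilb) (h : H) :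
    ∑ i, (inner ℂ (stdOrthonormalBasis ℂ H i) h : ℂ) • stdOrthonormalBasis ℂ H i = h :=
  (stdOrthonormalBasis ℂ H).sum_repr' h

theorem sum_smul_bar (H : FHilb) (ξ : dual H) :
    ∑ i, (functional ξ (stdOrthonormalBasis ℂ H i)) • bar (stdOrthonormalBasis ℂ H i) = ξ := by
  obtain ⟨x, rfl⟩ := (InnerProductSpace.toDual ℂ H).surjective ξ
  change _ = InnerProductSpace.toDual ℂ H x
  conv_rhs => rw [← sum_inner_smul H x, map_sum]
  refine Finset.sum_congr rfl fun i _ => ?_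
  rw [map_smulₛₗ, inner_conj_symm]
  rfl

theorem dagger_isoOfEquiv {H K : FHilb} (e : H ≃ₗᵢ[ℂ] K) :
    LinearMap.adjoint e.toLinearEquiv.toLinearMap = e.symm.toLinearEquiv.toLinearMap := by
  symm
  rw [LinearMap.eq_adjoint_iff]
  intro x y
  change inner ℂ (e.symm x) y = inner ℂ x (e y)
  rw [← e.inner_map_map, e.apply_symm_apply]

theorem inner_bar {H : FHilb} (e : H) (ξ : dual H) :
    inner ℂ (bar e) ξ = functional ξ e := by
  change inner ℂ ((InnerProductSpace.toDual ℂ H).symm (functional ξ))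
    ((InnerProductSpace.toDual ℂ H).symm (InnerProductSpace.toDual ℂ H e)) = _
  rw [LinearIsometryEquiv.symm_apply_apply, InnerProductSpace.toDual_symm_apply]

instance instExactPairing (H : FHilb) : ExactPairing (dual H) H where
  coevaluation' := ⟨LinearMap.toSpanSingleton ℂ _ (cupVector H)⟩
  evaluation' := ⟨capMap H⟩
  coevaluation_evaluation' := by
    apply hom_ext
    apply TensorProduct.ext'
    intro h c
    change (TensorProduct.map (capMap H) LinearMap.id) ((TensorProduct.assoc ℂ H (dual H) H).symm
      (h ⊗ₜ ((show ℂ from c) • cupVector H))) = (1 : ℂ) ⊗ₜ[ℂ] ((show ℂ from c) • h)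
    rw [TensorProduct.tmul_smul, TensorProduct.tmul_smul, map_smul, map_smul, cupVector,
      TensorProduct.tmul_sum, map_sum, map_sum]
    congr 1
    conv_rhs => rw [← sum_inner_smul H h, TensorProduct.tmul_sum]
    refine Finset.sum_congr rfl fun i _ => ?_
    rw [TensorProduct.assoc_symm_tmul, TensorProduct.map_tmul, capMap_bar,
      ← TensorProduct.smul_tmul, smul_eq_mul, mul_one, LinearMap.id_apply]
  evaluation_coevaluation' := by
    apply hom_ext
    apply TensorProduct.ext'
    intro c ξ
    change (TensorProduct.map LinearMap.id (capMap H)) (TensorProduct.assoc ℂ (dual H) H (dual H)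
      (((show ℂ from c) • cupVector H) ⊗ₜ ξ)) = ((show ℂ from c) • ξ) ⊗ₜ[ℂ] (1 : ℂ)
    rw [← TensorProduct.smul_tmul', ← TensorProduct.smul_tmul', map_smul, map_smul, cupVector,
      TensorProduct.sum_tmul, map_sum, map_sum]
    congr 1
    conv_rhs => rw [← sum_smul_bar H ξ, TensorProduct.sum_tmul]
    refine Finset.sum_congr rfl fun i _ => ?_
    rw [TensorProduct.assoc_tmul, TensorProduct.map_tmul, capMap_tmul,
      TensorProduct.smul_tmul, smul_eq_mul, mul_one, LinearMap.id_apply]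

instance : LeftRigidCategory FHilb where
  leftDual H := { leftDual := dual H }

instance : DaggerCompactCategory FHilb where
  dagger f := ⟨LinearMap.adjoint f.lin⟩
  dagger_id _ := hom_ext LinearMap.adjoint_id
  dagger_comp f g := hom_ext (LinearMap.adjoint_comp g.lin f.lin)
  dagger_dagger f := hom_ext (LinearMap.adjoint_adjoint f.lin)
  dagger_tensorHom f g := hom_ext (TensorProduct.adjoint_map f.lin g.lin)
  dagger_associator H K L := hom_ext <|
    dagger_isoOfEquiv (H := (H ⊗ K) ⊗ L) (K := H ⊗ K ⊗ L) (TensorProduct.assocIsometry ℂ H K L)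
  dagger_leftUnitor H := hom_ext <|
    dagger_isoOfEquiv (H := 𝟙_ FHilb ⊗ H) (K := H) (TensorProduct.lidIsometry ℂ H)
  dagger_rightUnitor H := hom_ext <|
    dagger_isoOfEquiv (H := H ⊗ 𝟙_ FHilb) (K := H)
      (TensorProduct.ridIsometry ℂ H)
  dagger_braiding H K := hom_ext <|
    dagger_isoOfEquiv (H := H ⊗ K) (K := K ⊗ H) (TensorProduct.commIsometry ℂ H K)
  dagger_evaluation H := by
    apply hom_ext
    apply LinearMap.ext_ring
    change TensorProduct.comm ℂ H (dual H) (LinearMap.adjoint (capMap H) (1 : ℂ)) =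
      (1 : ℂ) • cupVector H
    rw [one_smul, ← LinearEquiv.eq_symm_apply, cupVector, map_sum]
    change _ = ∑ i, stdOrthonormalBasis ℂ H i ⊗ₜ[ℂ] bar (stdOrthonormalBasis ℂ H i)
    rw [TensorProduct.ext_iff_inner_right]
    intro h ξ
    rw [LinearMap.adjoint_inner_left, sum_inner]
    conv_rhs =>
      enter [2, i]
      rw [TensorProduct.inner_tmul, inner_bar]
    have h2 : ∑ i, inner ℂ (stdOrthonormalBasis ℂ H i) h *
        functional ξ (stdOrthonormalBasis ℂ H i) =
        functional ξ h := by
      conv_rhs => rw [← sum_inner_smul H h, map_sum]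
      exact Finset.sum_congr rfl fun i _ => by rw [map_smul, smul_eq_mul]
    rw [h2]
    change inner ℂ (1 : ℂ) (functional ξ h) = _
    simp

end FHilb

/-! ### Finite-dimensional C*-algebras and completely positive maps -/

/-- A linear map `f : A → B` between C*-algebras is completely positive when, for every `n`,
`f ⊗ id : A ⊗ M_n → B ⊗ M_n` sends positive elements, those of the form `b⋆ b`, to positive
elements. -/
def IsCompletelyPositive {A B : Type*} [CStarAlgebra A] [CStarAlgebra B] (f : A →ₗ[ℂ] B) : Prop :=
  ∀ (n : ℕ) (b : A ⊗[ℂ] Matrix (Fin n) (Fin n) ℂ),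
    ∃ c : B ⊗[ℂ] Matrix (Fin n) (Fin n) ℂ,
      f.rTensor (Matrix (Fin n) (Fin n) ℂ) (star b * b) = star c * c

/-- Finite-dimensional C*-algebras. -/
structure FdCStarAlg where
  carrier : Type
  [cstarAlgebra : CStarAlgebra carrier]
  [finiteDimensional : FiniteDimensional ℂ carrier]

namespace FdCStarAlg

instance : CoeSort FdCStarAlg Type := ⟨FdCStarAlg.carrier⟩

attribute [instance] cstarAlgebra finiteDimensional

/-- Completely positive maps. -/
@[ext]
structure Hom (A B : FdCStarAlg) where
  lin : A →ₗ[ℂ] B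
  completelyPositive : IsCompletelyPositive lin

/-- The category of finite-dimensional C*-algebras and completely positive maps. -/
instance : Category FdCStarAlg where
  Hom A B := Hom A B
  id A := ⟨LinearMap.id, fun n b => ⟨b, by simp⟩⟩
  comp f g := ⟨g.lin ∘ₗ f.lin, fun n b => by
    obtain ⟨c, hc⟩ := f.completelyPositive n b
    obtain ⟨d, hd⟩ := g.completelyPositive n c
    exact ⟨d, by rw [LinearMap.rTensor_comp_apply, hc, hd]⟩⟩

end FdCStarAlg

end

open CategoryTheory MonoidalCategory
open scoped TensorProduct

open DaggerCategory

noncomputable section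

universe v u

/-! ### Positivity tested against a faithful positive functional. -/

section PositiveFunctionals

open ComplexOrder

variable {M : Type*} [CStarAlgebra M] {T : M →ₗ[ℂ] ℂ}

/-! The comparison goes through the left regular representation. In a normalisable dagger Frobenius
algebra `A` the Frobenius law makes each adjoint `L_a†` commute with right multiplications, so it is
again a left multiplication (`adjoint_bilin_apply`). Hence the left multiplications form a
C*-algebra, identified with `A` by evaluation at the unit. The functional `τ = ⟪1, ·⟫` satisfies `τ
(a⋆ b) = ⟪a, b⟫`, so it is positive and faithful; normalisability writes `τ a` as the trace of left
multiplication by `z² a`, so it is tracial.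

On morphisms, bending wires turns the CP*-condition into the identity `x · f (a⋆ a') = ∑ₖ ⟪gₖ a, x⟫
gₖ a'` for Kraus operators `gₖ`. By Choi's argument such operators exist exactly when all sums `∑
⟪xⱼ, xᵢ · f (aᵢ⋆ aⱼ)⟫` are nonnegative (`cpStarCondition_iff_forall_sum_nonneg`). On the C*-side,
positivity of a matrix can be tested against a faithful positive functional, so complete positivity
means that all sums `∑ τ (yᵢ⋆ f (aᵢ⋆ aⱼ) yⱼ)` are nonnegative
(`isCompletelyPositive_iff_forall_sum_nonneg`). Traciality and `xᵢ = yᵢ⋆` identify the two criteria.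
This gives closure under composition and a fully faithful functor.

For essential surjectivity, the trace of the regular representation of a finite-dimensional
C*-algebra is positive, faithful and tracial. The inner product `Tr L_(a⋆ b)` then yields a dagger
Frobenius algebra, normalised by `z = 1`. -/

theorem map_star_of_forall_nonneg (hT : ∀ x, 0 ≤ T (star x * x)) (x : M) :
    T (star x) = star (T x) := by
  -- Polarisation: `T` is real on `(y + 1)⋆ (y + 1)`, `y⋆ y` and `1`, so `T y⋆ + T y` is real.
  -- Applying this to `x` and `i x` gives the two components.
  have key : ∀ y : M, (T (star y)).im + (T y).im = 0 := fun y => by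
    have h1 := (Complex.nonneg_iff.1 (hT (y + 1))).2
    have h2 := (Complex.nonneg_iff.1 (hT y)).2
    have h3 := (Complex.nonneg_iff.1 (hT 1)).2
    simp only [star_add, star_one, add_mul, mul_add, one_mul, mul_one, map_add,
      Complex.add_im] at h1 h3
    linarith
  have h1 := key x
  have h2 := key (Complex.I • x)
  simp [star_smul] at h2
  apply Complex.ext
  · simp; linarith
  · simp; linarith

/-- An element `F` with `T (Y⋆ F Y) ≥ 0` for all `Y`, where `T` is a faithful positive functional,
is of the form `N⋆ N`. -/
theorem exists_star_mul_self_of_forall_conj_nonneg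
    (hT : ∀ x, 0 ≤ T (star x * x)) (hT' : ∀ x, T (star x * x) = 0 → x = 0)
    {F : M} (hF : ∀ Y, 0 ≤ T (star Y * F * Y)) : ∃ N, F = star N * N := by
  let _ : PartialOrder M := CStarAlgebra.spectralOrder M
  let _ : StarOrderedRing M := CStarAlgebra.spectralOrderedRing M
  have hsa : IsSelfAdjoint F := by
    have hD : ∀ Y, T (star Y * (F - star F) * Y) = 0 := fun Y => by
      have h1 : star Y * star F * Y = star (star Y * F * Y) := by simp [mul_assoc]
      have h2 := (Complex.nonneg_iff.1 (hF Y)).2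
      rw [mul_sub, sub_mul, map_sub, h1, map_star_of_forall_nonneg hT, sub_eq_zero]
      apply Complex.ext
      · simp
      · simp [← h2]
    generalize hDF : F - star F = D at hD
    have hDs : star D = -D := by simp [← hDF]
    -- `D` is skew-adjoint. The cubic and linear terms at `Y = D + i` vanish by the cases `Y = D`
    -- and `Y = 1`, leaving `T (D²) = 0`, that is `T (D⋆ D) = 0`.
    have h1 := hD D
    have h2 := hD 1
    have h3 := hD (D + Complex.I • 1)
    simp [add_mul, mul_add, hDs, mul_assoc] at h1 h2 h3
    simp [h1, h2] at h3
    have h5 := hT' D (by rw [hDs, neg_mul, map_neg, h3, neg_zero])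
    rw [h5, sub_eq_zero] at hDF
    exact hDF.symm
  -- Testing on `Y = F⁻` gives `-T ((F⁻)³) ≥ 0`. With `F⁻ = s⋆ s` the cube is `(s F⁻)⋆ (s F⁻)`, so
  -- faithfulness kills `s F⁻` and hence `F⁻`.
  have hN : 0 ≤ F⁻ := CFC.negPart_nonneg F
  have hFN : F⁻ * F * F⁻ = -(F⁻ * F⁻ * F⁻) := by
    conv_lhs => enter [1, 2]; rw [← CFC.posPart_sub_negPart F hsa]
    rw [mul_sub, CFC.negPart_mul_posPart, zero_sub, neg_mul]
  obtain ⟨s, hs⟩ := CStarAlgebra.nonneg_iff_eq_star_mul_self.1 hN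
  have hNs : star F⁻ = F⁻ := (IsSelfAdjoint.of_nonneg hN).star_eq
  have h3 : star (s * F⁻) * (s * F⁻) = F⁻ * F⁻ * F⁻ := by
    rw [star_mul, hNs]
    conv_rhs => enter [1, 2]; rw [hs]
    simp only [mul_assoc]
  have h4 := hF F⁻
  rw [hNs, hFN, map_neg, ← h3] at h4
  have h5 := hT' _ (le_antisymm (neg_nonneg.1 h4) (hT _))
  have h6 : star F⁻ * F⁻ = 0 := by
    rw [hNs]
    conv_lhs => enter [1]; rw [hs]
    rw [mul_assoc, h5, mul_zero]
  rw [CStarRing.star_mul_self_eq_zero_iff] at h6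
  refine CStarAlgebra.nonneg_iff_eq_star_mul_self.1 ?_
  rw [← CFC.posPart_sub_negPart F hsa, h6, sub_zero]
  exact CFC.posPart_nonneg F

end PositiveFunctionals

/-! ### Complete positivity as positivity of kernels. -/

section Criterion

open ComplexOrder Matrix

variable {A B : Type*} [CStarAlgebra A] [CStarAlgebra B]

theorem star_matrixEquivTensor {n : ℕ} (M : Matrix (Fin n) (Fin n) A) :
    star (matrixEquivTensor (Fin n) ℂ A M) = matrixEquivTensor (Fin n) ℂ A (star M) := by
  rw [matrixEquivTensor_apply, matrixEquivTensor_apply, star_sum,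
    ← Equiv.sum_comp (Equiv.prodComm (Fin n) (Fin n))]
  refine Finset.sum_congr rfl fun p _ => ?_
  simp [star_eq_conjTranspose, conjTranspose_single]

theorem rTensor_matrixEquivTensor (f : A →ₗ[ℂ] B) {n : ℕ} (M : Matrix (Fin n) (Fin n) A) :
    f.rTensor _ (matrixEquivTensor (Fin n) ℂ A M) = matrixEquivTensor (Fin n) ℂ B (M.map f) := by
  simp only [matrixEquivTensor_apply, map_sum, LinearMap.rTensor_tmul, map_apply]

/-- Complete positivity in terms of matrices over the algebras. -/
theorem isCompletelyPositive_iff_matrix (f : A →ₗ[ℂ] B) :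
    IsCompletelyPositive f ↔ ∀ (n : ℕ) (M : Matrix (Fin n) (Fin n) A),
      ∃ N : Matrix (Fin n) (Fin n) B, (star M * M).map f = star N * N := by
  refine forall_congr' fun n => ((matrixEquivTensor (Fin n) ℂ A).toEquiv.forall_congr fun M => ?_).symm
  change _ ↔ ∃ c, f.rTensor _ (star (matrixEquivTensor (Fin n) ℂ A M) *
    matrixEquivTensor (Fin n) ℂ A M) = star c * c
  rw [star_matrixEquivTensor, ← map_mul, rTensor_matrixEquivTensor,
    ← (matrixEquivTensor (Fin n) ℂ B).toEquiv.exists_congr_right]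
  refine exists_congr fun N => ?_
  change _ ↔ _ = star (matrixEquivTensor (Fin n) ℂ B N) * matrixEquivTensor (Fin n) ℂ B N
  rw [star_matrixEquivTensor, ← map_mul, EmbeddingLike.apply_eq_iff_eq]

variable {τ : B →ₗ[ℂ] ℂ}

/-- A matrix over `B` that is positive against a faithful positive functional is positive. -/
theorem exists_star_mul_self_of_forall_sum_nonneg (hτ : ∀ x, 0 ≤ τ (star x * x))
    (hτ' : ∀ x, τ (star x * x) = 0 → x = 0) {ι : Type*} [Fintype ι] [DecidableEq ι]
    (F : Matrix ι ι B) (hF : ∀ y : ι → B, 0 ≤ ∑ i, ∑ j, τ (star (y i) * F i j * y j)) :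
    ∃ N : Matrix ι ι B, F = star N * N := by
  let _ : PartialOrder B := CStarAlgebra.spectralOrder B
  let _ : StarOrderedRing B := CStarAlgebra.spectralOrderedRing B
  -- The functional `τ ∘ Tr` is positive and faithful on matrices; testing it on `Y` splits into one
  -- instance of `hF` for each column of `Y`.
  let T : CStarMatrix ι ι B →ₗ[ℂ] ℂ :=
    { toFun := fun Y => ∑ i, τ (Y i i)
      map_add' := fun Y Z => by simp [Finset.sum_add_distrib]
      map_smul' := fun c Y => by simp [Finset.mul_sum] }
  have hT : ∀ x, T (star x * x) = ∑ l, ∑ k, τ (star (x k l) * x k l) := fun x => by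
    simp [T, CStarMatrix.mul_apply, CStarMatrix.star_apply]
  have h0 : ∃ N, CStarMatrix.ofMatrix F = star N * N := by
    refine exists_star_mul_self_of_forall_conj_nonneg (T := T) (fun x => ?_) (fun x hx => ?_) (fun Y => ?_)
    · rw [hT]
      exact Finset.sum_nonneg fun _ _ => Finset.sum_nonneg fun _ _ => hτ _
    · rw [hT, Finset.sum_eq_zero_iff_of_nonneg
        fun _ _ => Finset.sum_nonneg fun _ _ => hτ _] at hx
      ext k l
      have h1 := hx l (Finset.mem_univ l)
      rw [Finset.sum_eq_zero_iff_of_nonneg fun _ _ => hτ _] at h1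
      exact hτ' _ (h1 k (Finset.mem_univ k))
    · have h1 : T (star Y * CStarMatrix.ofMatrix F * Y) =
          ∑ l, ∑ i, ∑ j, τ (star (Y i l) * F i j * Y j l) := by
        simp only [T, LinearMap.coe_mk, AddHom.coe_mk, CStarMatrix.mul_apply,
          CStarMatrix.star_apply, Finset.sum_mul, map_sum]
        exact Finset.sum_congr rfl fun l _ => Finset.sum_comm
      rw [h1]
      exact Finset.sum_nonneg fun l _ => hF fun i => Y i l
  obtain ⟨N, hN⟩ := h0
  exact ⟨CStarMatrix.ofMatrix.symm N, hN⟩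

/-- Complete positivity as positivity of the kernels `f (aᵢ⋆ aⱼ)` against a faithful positive
functional. -/
theorem isCompletelyPositive_iff_forall_sum_nonneg (hτ : ∀ x, 0 ≤ τ (star x * x))
    (hτ' : ∀ x, τ (star x * x) = 0 → x = 0) (f : A →ₗ[ℂ] B) :
    IsCompletelyPositive f ↔ ∀ (n : ℕ) (a : Fin n → A) (y : Fin n → B),
      0 ≤ ∑ i, ∑ j, τ (star (y i) * f (star (a i) * a j) * y j) := by
  rw [isCompletelyPositive_iff_matrix]
  refine ⟨fun h n a y => ?_, fun h n M => ?_⟩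
  · rcases isEmpty_or_nonempty (Fin n) with _ | ⟨⟨p⟩⟩
    · simp
    · obtain ⟨N, hN⟩ := h n (Matrix.of fun k j => if k = p then a j else 0)
      have h1 : ∀ i j, f (star (a i) * a j) = ∑ k, star (N k i) * N k j := fun i j => by
        have := congrFun (congrFun hN i) j
        simpa [Matrix.mul_apply, Matrix.star_apply] using this
      have h2 : ∑ i, ∑ j, τ (star (y i) * f (star (a i) * a j) * y j) =
          ∑ k, τ (star (∑ i, N k i * y i) * ∑ j, N k j * y j) := by
        simp only [h1, Finset.mul_sum, Finset.sum_mul, star_sum, star_mul, map_sum, mul_assoc]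
        rw [Finset.sum_comm]
        conv_rhs => rw [Finset.sum_comm]
        refine Finset.sum_congr rfl fun j _ => ?_
        rw [Finset.sum_comm]
      rw [h2]
      exact Finset.sum_nonneg fun k _ => hτ _
  · refine exists_star_mul_self_of_forall_sum_nonneg hτ hτ' _ fun y => ?_
    -- Conversely `M⋆ M` is the sum over its rows of such rank-one kernels.
    have h2 : ∑ i, ∑ j, τ (star (y i) * (star M * M).map f i j * y j) =
        ∑ k, ∑ i, ∑ j, τ (star (y i) * f (star (M k i) * M k j) * y j) := by
      simp only [Matrix.map_apply, Matrix.mul_apply, Matrix.star_apply, map_sum, Finset.mul_sum,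
        Finset.sum_mul]
      conv_rhs => rw [Finset.sum_comm]
      refine Finset.sum_congr rfl fun i _ => ?_
      rw [Finset.sum_comm]
    rw [h2]
    exact Finset.sum_nonneg fun k _ => h n (M k) y

end Criterion

/-! ### The graphical operations evaluated on vectors. -/

namespace FHilb

variable {H K L : FHilb}

/-- Contraction of the first factor of `H ⊗ K` against a vector. -/
def contract (K : FHilb) (c : H) : H ⊗[ℂ] K →ₗ[ℂ] K :=
  (TensorProduct.lid ℂ K).toLinearMap ∘ₗ TensorProduct.map (innerₛₗ ℂ c) LinearMap.id

@[simp] theorem contract_tmul (c h : H) (k : K) :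
    contract K c (h ⊗ₜ k) = (inner ℂ c h : ℂ) • k := by
  simp [contract]

theorem inner_contract (c : H) (k : K) (t : H ⊗[ℂ] K) :
    inner ℂ k (contract K c t) = inner ℂ (c ⊗ₜ[ℂ] k) t := by
  induction t with
  | zero => simp
  | tmul x y => rw [contract_tmul, inner_smul_right, TensorProduct.inner_tmul]
  | add x y hx hy => rw [map_add, inner_add_right, inner_add_right, hx, hy]

/-- The bilinear map underlying a morphism `H ⊗ H ⟶ H`. -/
def bilin (m : H ⊗ H ⟶ H) : H →ₗ[ℂ] H →ₗ[ℂ] H :=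
  TensorProduct.curry (show H ⊗[ℂ] H →ₗ[ℂ] H from m.lin)

theorem lin_tmul (m : H ⊗ H ⟶ H) (a b : H) : m.lin (a ⊗ₜ[ℂ] b) = bilin m a b := rfl

theorem dagger_lin (f : H ⟶ K) : (dagger f).lin = LinearMap.adjoint f.lin := rfl

/-- Bending an output of the comultiplication down amounts to taking the adjoint of a left
multiplication; this is how `a⋆ b` enters the coaction. -/
theorem adjoint_bilin (m : H ⊗ H ⟶ H) (a b : H) :
    LinearMap.adjoint (bilin m a) b = contract H a ((dagger m).lin b) := by
  refine ext_inner_left ℂ fun x => ?_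
  rw [inner_contract, LinearMap.adjoint_inner_right]
  exact (LinearMap.adjoint_inner_right m.lin (a ⊗ₜ[ℂ] x) b).symm

theorem inner_bar_bar (c e : H) : (inner ℂ (bar c) (bar e) : ℂ) = inner ℂ e c := by
  rw [inner_bar]; rfl

theorem dagger_cup_lin (c h : H) :
    (dagger (CPStarConstruction.cup H)).lin (bar c ⊗ₜ[ℂ] h) = (inner ℂ c h : ℂ) := by
  have h1 := LinearMap.adjoint_inner_right (CPStarConstruction.cup H).lin (1 : ℂ) (bar c ⊗ₜ[ℂ] h)
  have h2 : (CPStarConstruction.cup H).lin (1 : ℂ) = cupVector H := one_smul ℂ _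
  have h3 : inner ℂ (cupVector H) (bar c ⊗ₜ[ℂ] h) = (inner ℂ c h : ℂ) := by
    rw [cupVector, sum_inner, ← (stdOrthonormalBasis ℂ H).sum_inner_mul_inner c h]
    refine Finset.sum_congr rfl fun i _ => ?_
    rw [TensorProduct.inner_tmul, inner_bar_bar]
  rw [h2, h3] at h1
  rw [← h1, dagger_lin]
  change _ = (inner ℂ (1 : ℂ) (_ : ℂ) : ℂ)
  simp

theorem lid_dagger_cup (c : H) (t : H ⊗[ℂ] K) :
    TensorProduct.lid ℂ K (TensorProduct.map (dagger (CPStarConstruction.cup H)).lin LinearMap.id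
      ((TensorProduct.assoc ℂ (dual H) H K).symm (bar c ⊗ₜ[ℂ] t))) = contract K c t := by
  induction t with
  | zero => simp
  | tmul x y =>
    rw [contract_tmul, TensorProduct.assoc_symm_tmul, TensorProduct.map_tmul, dagger_cup_lin]
    exact TensorProduct.lid_tmul _ _
  | add x y hx hy => rw [TensorProduct.tmul_add, map_add, map_add, map_add, map_add, hx, hy]

theorem dagger_cap_lin (H : FHilb) :
    (dagger (CPStarConstruction.cap H)).lin (1 : ℂ) =
      ∑ i, stdOrthonormalBasis ℂ H i ⊗ₜ[ℂ] bar (stdOrthonormalBasis ℂ H i) := by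
  have h := congrArg (fun f : 𝟙_ FHilb ⟶ _ => f.lin (1 : ℂ))
    (DaggerCompactCategory.dagger_evaluation H)
  change TensorProduct.comm ℂ H (dual H) ((dagger (CPStarConstruction.cap H)).lin (1 : ℂ)) =
    (1 : ℂ) • cupVector H at h
  rw [one_smul, ← LinearEquiv.eq_symm_apply, cupVector, map_sum] at h
  exact h

/-- The partial trace of a multiplication is the trace of the left regular representation. -/
theorem mulTrace_lin (m : H ⊗ H ⟶ H) (a : H) :
    (CPStarConstruction.mulTrace m).lin a = LinearMap.trace ℂ H (bilin m a) := by
  rw [LinearMap.trace_eq_sum_inner _ (stdOrthonormalBasis ℂ H)]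
  change capMap H ((TensorProduct.map m.lin LinearMap.id)
    ((TensorProduct.assoc ℂ H H (dual H)).symm
      (a ⊗ₜ[ℂ] (dagger (CPStarConstruction.cap H)).lin (1 : ℂ)))) = _
  rw [dagger_cap_lin, TensorProduct.tmul_sum, map_sum, map_sum, map_sum]
  refine Finset.sum_congr rfl fun i _ => ?_
  rw [TensorProduct.assoc_symm_tmul, TensorProduct.map_tmul, LinearMap.id_apply, capMap_bar]
  rfl

variable {A B X : FHilb}

/-- The components of a map into a tensor product `X ⊗ B`. -/
def kraus (g : A ⟶ X ⊗ B) (k : Fin (Module.finrank ℂ X)) : A →ₗ[ℂ] B :=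
  contract B (stdOrthonormalBasis ℂ X k) ∘ₗ g.lin

theorem inner_kraus (g : A ⟶ X ⊗ B) (k) (a : A) (b : B) :
    (inner ℂ (kraus g k a) b : ℂ) = inner ℂ a ((dagger g).lin
      (stdOrthonormalBasis ℂ X k ⊗ₜ[ℂ] b)) := by
  rw [dagger_lin, LinearMap.adjoint_inner_right, ← inner_conj_symm, kraus, LinearMap.comp_apply,
    inner_contract]
  exact inner_conj_symm (𝕜 := ℂ) (g.lin a : X ⊗[ℂ] B) _

/-- Spells out the coherence isomorphisms implicit in the nested cup, so that it can be evaluated on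
vectors. -/
theorem coevaluation_tensor {V : Type u} [Category.{v} V] [MonoidalCategory V] (X₁ X₂ Y₁ Y₂ : V)
    [ExactPairing X₁ Y₁] [ExactPairing X₂ Y₂] :
    ExactPairing.coevaluation (X₁ ⊗ X₂) (Y₂ ⊗ Y₁) =
      ExactPairing.coevaluation X₁ Y₁ ≫ (ρ_ X₁).inv ▷ Y₁ ≫
        (X₁ ◁ ExactPairing.coevaluation X₂ Y₂) ▷ Y₁ ≫ (α_ X₁ X₂ Y₂).inv ▷ Y₁ ≫
        (α_ (X₁ ⊗ X₂) Y₂ Y₁).hom := by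
  change ExactPairing.coevaluation X₁ Y₁ ⊗≫ (X₁ ◁ ExactPairing.coevaluation X₂ Y₂) ▷ Y₁ ⊗≫ 𝟙 _ = _
  monoidal

theorem coevaluation_tensor_lin (X B : FHilb) :
    (ExactPairing.coevaluation (dual B ⊗ dual X : FHilb) (X ⊗ B : FHilb)).lin (1 : ℂ) =
      ∑ p, ∑ k, (bar (stdOrthonormalBasis ℂ B p) ⊗ₜ[ℂ] bar (stdOrthonormalBasis ℂ X k)) ⊗ₜ[ℂ]
        (stdOrthonormalBasis ℂ X k ⊗ₜ[ℂ] stdOrthonormalBasis ℂ B p) := by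
  rw [coevaluation_tensor]
  change TensorProduct.assoc ℂ (dual B ⊗[ℂ] dual X) X B (TensorProduct.map
    (TensorProduct.assoc ℂ (dual B) (dual X) X).symm.toLinearMap LinearMap.id
    (TensorProduct.map (TensorProduct.map LinearMap.id
      (LinearMap.toSpanSingleton ℂ _ (cupVector X))) LinearMap.id
      (TensorProduct.map (TensorProduct.rid ℂ (dual B)).symm.toLinearMap LinearMap.id
        ((1 : ℂ) • cupVector B)))) = _
  rw [one_smul]
  simp only [cupVector, map_sum, TensorProduct.map_tmul, LinearEquiv.coe_coe,
    TensorProduct.rid_symm_apply, LinearMap.id_apply, LinearMap.toSpanSingleton_apply, one_smul,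
    TensorProduct.tmul_sum, TensorProduct.sum_tmul, TensorProduct.assoc_symm_tmul,
    TensorProduct.assoc_tmul]

theorem conj_eq {V : Type u} [Category.{v} V] [MonoidalCategory V] [SymmetricCategory V]
    [LeftRigidCategory V] [DaggerCompactCategory V] {A B X : V} (g : A ⟶ X ⊗ B) :
    CPStarConstruction.conj g = (λ_ _).inv ≫
      ExactPairing.coevaluation (CPStarConstruction.dual B ⊗ CPStarConstruction.dual X) (X ⊗ B) ▷
        CPStarConstruction.dual A ≫ (_ ◁ dagger g) ▷ _ ≫ (α_ _ _ _).hom ≫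
      _ ◁ CPStarConstruction.cap A ≫ (ρ_ _).hom := rfl

theorem conj_lin (g : A ⟶ X ⊗ B) (a : A) :
    (CPStarConstruction.conj g).lin (bar a) = ∑ p, ∑ k,
      (inner ℂ (kraus g k a) (stdOrthonormalBasis ℂ B p) : ℂ) •
        (bar (stdOrthonormalBasis ℂ B p) ⊗ₜ[ℂ] bar (stdOrthonormalBasis ℂ X k)) := by
  simp only [inner_kraus]
  have h := coevaluation_tensor_lin X B
  rw [conj_eq]
  change TensorProduct.rid ℂ (dual B ⊗[ℂ] dual X) (TensorProduct.map LinearMap.id (capMap A)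
    (TensorProduct.assoc ℂ (dual B ⊗[ℂ] dual X) A (dual A)
      (TensorProduct.map (TensorProduct.map LinearMap.id (dagger g).lin) LinearMap.id
        ((ExactPairing.coevaluation (dual B ⊗ dual X : FHilb) (X ⊗ B : FHilb)).lin (1 : ℂ)
          ⊗ₜ[ℂ] bar a)))) = _
  rw [h]
  simp only [TensorProduct.sum_tmul, map_sum, TensorProduct.map_tmul, TensorProduct.assoc_tmul,
    LinearMap.id_apply, capMap_bar, TensorProduct.rid_tmul]

/-- Capping `X^*` against `X` leaves `∑ₖ (gₖ)_* ⊗ gₖ`. The first factor is expanded in a basis to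
match the shape of `action_lin`. -/
theorem doubled_lin (g : A ⟶ X ⊗ B) (a a' : A) :
    (CPStarConstruction.doubled g).lin (bar a ⊗ₜ[ℂ] a') =
      ∑ p, bar (stdOrthonormalBasis ℂ B p) ⊗ₜ[ℂ]
        ∑ k, (inner ℂ (kraus g k a) (stdOrthonormalBasis ℂ B p) : ℂ) • kraus g k a' := by
  change TensorProduct.map LinearMap.id ((TensorProduct.lid ℂ B).toLinearMap ∘ₗ
    TensorProduct.map (dagger (CPStarConstruction.cup X)).lin LinearMap.id ∘ₗ
      (TensorProduct.assoc ℂ (dual X) X B).symm.toLinearMap)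
    (TensorProduct.assoc ℂ (dual B) (dual X) (X ⊗[ℂ] B)
      ((CPStarConstruction.conj g).lin (bar a) ⊗ₜ[ℂ] g.lin a')) = _
  rw [conj_lin]
  simp only [TensorProduct.sum_tmul, map_sum, ← TensorProduct.smul_tmul', map_smul,
    TensorProduct.assoc_tmul, TensorProduct.map_tmul, LinearMap.comp_apply, LinearEquiv.coe_coe,
    LinearMap.id_apply, TensorProduct.tmul_sum, TensorProduct.tmul_smul]
  refine Finset.sum_congr rfl fun p _ => Finset.sum_congr rfl fun k _ => ?_
  congr 2
  exact lid_dagger_cup _ _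

end FHilb

namespace CPStarConstruction.NormalisableAlgebra

open FHilb

variable (A : NormalisableAlgebra FHilb)

theorem action_lin (b : A.carrier) :
    A.action.lin b = ∑ p, bar (stdOrthonormalBasis ℂ A.carrier p) ⊗ₜ[ℂ]
      bilin A.mul (stdOrthonormalBasis ℂ A.carrier p) b := by
  change TensorProduct.map LinearMap.id A.mul.lin (TensorProduct.assoc ℂ (FHilb.dual A.carrier)
    A.carrier A.carrier (((1 : ℂ) • cupVector A.carrier) ⊗ₜ b)) = _
  rw [one_smul, cupVector, TensorProduct.sum_tmul, map_sum, map_sum]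
  refine Finset.sum_congr rfl fun i _ => ?_
  rw [TensorProduct.assoc_tmul, TensorProduct.map_tmul]
  rfl

theorem coaction_lin (c b : A.carrier) :
    A.coaction.lin (bar c ⊗ₜ[ℂ] b) = LinearMap.adjoint (bilin A.mul c) b := by
  rw [adjoint_bilin]
  exact lid_dagger_cup (K := A.carrier) c ((dagger A.mul).lin b)

end CPStarConstruction.NormalisableAlgebra

/-! ### Choi's theorem and the Kraus form of the CP*-condition. -/

namespace FHilb

open ComplexOrder

/-- The Kraus identity obtained from Choi's argument is available only on basis vectors, so
morphisms are compared there. -/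
theorem ext_bar {H : FHilb} {Z : Type*} [AddCommGroup Z] [Module ℂ Z]
    {φ ψ : dual H ⊗[ℂ] H →ₗ[ℂ] Z}
    (h : ∀ i j, φ (bar (stdOrthonormalBasis ℂ H i) ⊗ₜ[ℂ] stdOrthonormalBasis ℂ H j) =
      ψ (bar (stdOrthonormalBasis ℂ H i) ⊗ₜ[ℂ] stdOrthonormalBasis ℂ H j)) : φ = ψ := by
  refine TensorProduct.ext' fun ξ x => ?_
  rw [← sum_smul_bar H ξ, ← sum_inner_smul H x]
  simp only [TensorProduct.sum_tmul, TensorProduct.tmul_sum, map_sum, ← TensorProduct.smul_tmul',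
    TensorProduct.tmul_smul, map_smul, h]

/-- Contraction of the first factor of `H* ⊗ K` against a vector. -/
def evalLeft {H : FHilb} (K : FHilb) (x : H) : dual H ⊗[ℂ] K →ₗ[ℂ] K :=
  contract K (bar x)

theorem evalLeft_bar_tmul {H K : FHilb} (x e : H) (k : K) :
    evalLeft K x (bar e ⊗ₜ[ℂ] k) = (inner ℂ e x : ℂ) • k := by
  rw [evalLeft, contract_tmul, inner_bar_bar]

theorem evalLeft_sum {H K : FHilb} (x : H) (φ : H →ₗ[ℂ] K) :
    evalLeft K x (∑ p, bar (stdOrthonormalBasis ℂ H p) ⊗ₜ[ℂ] φ (stdOrthonormalBasis ℂ H p)) =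
      φ x := by
  conv_rhs => rw [← sum_inner_smul H x]
  simp only [map_sum, evalLeft_bar_tmul, map_smul]

/-- A sesquilinear family of operators satisfying the positivity condition of Choi's theorem on
orthonormal bases is of Kraus form on these bases. -/
theorem exists_kraus_of_forall_sum_nonneg {A B : FHilb} (Φ : A → A → B →ₗ[ℂ] B)
    (hΦ : ∀ (n : ℕ) (a : Fin n → A) (x : Fin n → B),
      0 ≤ ∑ i, ∑ j, (inner ℂ (x j) (Φ (a i) (a j) (x i)) : ℂ)) :
    ∃ (n : ℕ) (g : Fin n → A →ₗ[ℂ] B), ∀ i j p,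
      Φ (stdOrthonormalBasis ℂ A i) (stdOrthonormalBasis ℂ A j) (stdOrthonormalBasis ℂ B p) =
        ∑ k, (inner ℂ (g k (stdOrthonormalBasis ℂ A i)) (stdOrthonormalBasis ℂ B p) : ℂ) •
          g k (stdOrthonormalBasis ℂ A j) := by
  set e := stdOrthonormalBasis ℂ A
  set b := stdOrthonormalBasis ℂ B
  -- The Choi matrix. The first arguments of `Φ` are transposed so that its quadratic form at `y` is
  -- the hypothesis at `xᵢ = ∑ₚ y (i, p) bₚ`; the matrix criterion over `ℂ` with `τ = id` then gives
  -- `F = N⋆ N`, and the conjugated rows of `N` are the Kraus operators.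
  let F : Matrix (Fin (Module.finrank ℂ A) × Fin (Module.finrank ℂ B))
      (Fin (Module.finrank ℂ A) × Fin (Module.finrank ℂ B)) ℂ :=
    Matrix.of fun s t => inner ℂ (b s.2) (Φ (e t.1) (e s.1) (b t.2))
  obtain ⟨N, hN⟩ := exists_star_mul_self_of_forall_sum_nonneg (τ := LinearMap.id)
    (fun x : ℂ => star_mul_self_nonneg x) (fun x hx => by simpa using hx) F fun y => by
      have h := hΦ _ e fun i => ∑ p, y (i, p) • b p
      convert h using 1
      rw [Finset.sum_comm]
      simp only [Fintype.sum_prod_type, map_sum, sum_inner, inner_sum, map_smul, inner_smul_left,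
        inner_smul_right, Finset.mul_sum]
      refine Finset.sum_congr rfl fun i _ => ?_
      rw [Finset.sum_comm]
      refine Finset.sum_congr rfl fun j _ => ?_
      refine Finset.sum_congr rfl fun p _ => Finset.sum_congr rfl fun q _ => ?_
      simp [F]
      ring
  let σ := Fintype.equivFin (Fin (Module.finrank ℂ A) × Fin (Module.finrank ℂ B))
  refine ⟨_, fun k => e.toBasis.constr ℂ fun i => ∑ p, star (N (σ.symm k) (i, p)) • b p,
    fun i j p => ?_⟩
  rw [σ.symm.sum_comp fun k =>
    (inner ℂ (e.toBasis.constr ℂ (fun i => ∑ p, star (N k (i, p)) • b p) (e i)) (b p) : ℂ) •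
      e.toBasis.constr ℂ (fun i => ∑ p, star (N k (i, p)) • b p) (e j)]
  have hg : ∀ k i, e.toBasis.constr ℂ (fun i => ∑ p, star (N k (i, p)) • b p) (e i) =
      ∑ p, star (N k (i, p)) • b p := fun k i => by
    rw [← e.coe_toBasis, Module.Basis.constr_basis]
  refine InnerProductSpace.ext_inner_left_basis b.toBasis fun q => ?_
  rw [b.coe_toBasis]
  have h := congrFun (congrFun hN (j, q)) (i, p)
  simp only [F, Matrix.of_apply, Matrix.mul_apply, Matrix.star_apply] at h
  rw [h, inner_sum]
  refine Finset.sum_congr rfl fun k _ => ?_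
  rw [hg, hg, inner_smul_right]
  simp only [sum_inner, inner_sum, inner_smul_left, inner_smul_right,
    OrthonormalBasis.inner_eq_ite]
  simp [mul_comm]

end FHilb

namespace CPStarConstruction.NormalisableAlgebra

open FHilb ComplexOrder

variable {A B : NormalisableAlgebra FHilb}

/-- The ancilla is `ℂⁿ`. The bijection `σ` is needed because Kraus components are indexed by the
dimension of `X`. -/
theorem exists_kraus_eq {A B : FHilb} {n : ℕ} (g : Fin n → A →ₗ[ℂ] B) :
    ∃ (X : FHilb) (G : A ⟶ X ⊗ B) (σ : Fin (Module.finrank ℂ X) ≃ Fin n),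
      ∀ k, kraus G k = g (σ k) := by
  let X : FHilb := ⟨EuclideanSpace ℂ (Fin n)⟩
  let σ : Fin (Module.finrank ℂ X) ≃ Fin n := finCongr finrank_euclideanSpace_fin
  refine ⟨X, ⟨∑ k, TensorProduct.mk ℂ X B (stdOrthonormalBasis ℂ X k) ∘ₗ g (σ k)⟩, σ, fun k => ?_⟩
  ext a
  rw [kraus, LinearMap.comp_apply]
  change contract B _ ((∑ k, TensorProduct.mk ℂ X B (stdOrthonormalBasis ℂ X k) ∘ₗ g (σ k)) a) = _
  simp [OrthonormalBasis.inner_eq_ite]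

/-- The CP*-condition in terms of Kraus operators. -/
theorem cpStarCondition_iff_forall_sum_nonneg (f : A ⟶ B) :
    cpStarCondition FHilb f ↔ ∀ (n : ℕ) (a : Fin n → A.carrier) (x : Fin n → B.carrier),
      0 ≤ ∑ i, ∑ j, (inner ℂ (x j) (bilin B.mul (x i) ((show A.carrier ⟶ B.carrier from f).lin
        (LinearMap.adjoint (bilin A.mul (a i)) (a j)))) : ℂ) := by
  set φ := (show A.carrier ⟶ B.carrier from f).lin
  constructor
  · rintro ⟨X, g, hg⟩ n a x
    have h : ∀ a a' x, bilin B.mul x (φ (LinearMap.adjoint (bilin A.mul a) a')) =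
        ∑ k, (inner ℂ (kraus g k a) x : ℂ) • kraus g k a' := fun a a' x => by
      have h1 := congrArg (fun u => evalLeft B.carrier x (Hom.lin u (bar a ⊗ₜ[ℂ] a'))) hg
      have h2 : Hom.lin (A.coaction ≫ (show A.carrier ⟶ B.carrier from f) ≫ B.action)
          (bar a ⊗ₜ[ℂ] a') = B.action.lin (φ (A.coaction.lin (bar a ⊗ₜ[ℂ] a'))) := rfl
      dsimp only at h1
      rw [h2, coaction_lin, action_lin, doubled_lin] at h1
      have h3 := evalLeft_sum x ((bilin B.mul).flip (φ (LinearMap.adjoint (bilin A.mul a) a')))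
      have h4 := evalLeft_sum x (∑ k, (innerₛₗ ℂ (kraus g k a)).smulRight (kraus g k a'))
      simp only [LinearMap.flip_apply, LinearMap.sum_apply, LinearMap.smulRight_apply,
        innerₛₗ_apply_apply] at h3 h4
      exact h3.symm.trans (h1.trans h4)
    -- In Kraus form the double sum is `∑ₖ |∑ᵢ ⟪gₖ aᵢ, xᵢ⟫|²`.
    have h5 : ∑ i, ∑ j, (inner ℂ (x j) (bilin B.mul (x i) (φ
        (LinearMap.adjoint (bilin A.mul (a i)) (a j)))) : ℂ) =
        ∑ k, star (∑ i, (inner ℂ (kraus g k (a i)) (x i) : ℂ)) *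
          ∑ i, (inner ℂ (kraus g k (a i)) (x i) : ℂ) := by
      simp only [h, inner_sum, inner_smul_right, star_sum, Finset.mul_sum, Finset.sum_mul]
      conv_rhs => rw [Finset.sum_comm]
      refine Finset.sum_congr rfl fun j _ => ?_
      rw [Finset.sum_comm]
      refine Finset.sum_congr rfl fun k _ => Finset.sum_congr rfl fun i _ => ?_
      rw [← inner_conj_symm (x i), mul_comm, starRingEnd_apply]
    rw [h5]
    exact Finset.sum_nonneg fun k _ => star_mul_self_nonneg _
  · intro h
    obtain ⟨n, g, hg⟩ := exists_kraus_of_forall_sum_nonneg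
      (fun a a' => (bilin B.mul).flip (φ (LinearMap.adjoint (bilin A.mul a) a'))) h
    obtain ⟨X, G, σ, hG⟩ := exists_kraus_eq g
    refine ⟨X, G, hom_ext (ext_bar fun i j => ?_)⟩
    refine Eq.trans ?_ (doubled_lin _ _ _).symm
    change B.action.lin (φ (A.coaction.lin _)) = _
    rw [coaction_lin, action_lin]
    refine Finset.sum_congr rfl fun p _ => ?_
    simp only [LinearMap.flip_apply] at hg
    rw [hg, ← σ.sum_comp]
    simp only [hG]

end CPStarConstruction.NormalisableAlgebra

/-! ### The C*-algebra of a normalisable dagger Frobenius algebra. -/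

namespace CPStarConstruction.NormalisableAlgebra

open FHilb ComplexOrder

variable (A : NormalisableAlgebra FHilb)

/-- The unit element. -/
def one : A.carrier := A.unit.lin (1 : ℂ)

theorem bilin_assoc (a b c : A.carrier) :
    bilin A.mul (bilin A.mul a b) c = bilin A.mul a (bilin A.mul b c) :=
  congrArg (fun f => Hom.lin f ((a ⊗ₜ[ℂ] b) ⊗ₜ[ℂ] c)) A.mul_assoc

theorem bilin_one_left (a : A.carrier) : bilin A.mul A.one a = a := by
  have h := congrArg (fun f => Hom.lin f ((1 : ℂ) ⊗ₜ[ℂ] a)) A.unit_mul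
  exact h.trans (one_smul ℂ a)

theorem bilin_one_right (a : A.carrier) : bilin A.mul a A.one = a := by
  have h := congrArg (fun f => Hom.lin f (a ⊗ₜ[ℂ] (1 : ℂ))) A.mul_unit
  exact h.trans (one_smul ℂ a)

/-- The adjoint of a left multiplication is a left multiplication. -/
theorem adjoint_bilin_apply (a b c : A.carrier) :
    LinearMap.adjoint (bilin A.mul a) (bilin A.mul b c) =
      bilin A.mul (LinearMap.adjoint (bilin A.mul a) b) c := by
  rw [adjoint_bilin, adjoint_bilin]
  have h := congrArg (fun f => Hom.lin f (b ⊗ₜ[ℂ] c)) A.frobenius_right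
  change TensorProduct.map LinearMap.id A.mul.lin (TensorProduct.assoc ℂ A.carrier A.carrier
    A.carrier ((dagger A.mul).lin b ⊗ₜ[ℂ] c)) = (dagger A.mul).lin (bilin A.mul b c) at h
  rw [← h]
  generalize (dagger A.mul).lin b = t
  change A.carrier ⊗[ℂ] A.carrier at t
  induction t with
  | zero => simp
  | tmul x y =>
    rw [TensorProduct.assoc_tmul, TensorProduct.map_tmul, contract_tmul, lin_tmul, contract_tmul,
      map_smul, LinearMap.smul_apply, LinearMap.id_apply]
  | add x y hx hy =>
    rw [TensorProduct.add_tmul, map_add, map_add, map_add, map_add, map_add, hx, hy,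
      LinearMap.add_apply]

/-- Normalisability expresses `⟪1, a⟫` as the trace of left multiplication by `z² a`. Centrality
splits `z² (ab)` as `(z a)(z b)`, and the operator trace is cyclic. -/
theorem inner_one_bilin_comm (a b : A.carrier) :
    (inner ℂ A.one (bilin A.mul a b) : ℂ) = inner ℂ A.one (bilin A.mul b a) := by
  obtain ⟨z, ⟨hz1, hz2⟩, -, hz⟩ := A.normalisable
  have h1 : ∀ a b, bilin A.mul (z.lin a) b = z.lin (bilin A.mul a b) := fun a b =>
    congrArg (fun f => Hom.lin f (a ⊗ₜ[ℂ] b)) hz1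
  have h2 : ∀ a b, bilin A.mul a (z.lin b) = z.lin (bilin A.mul a b) := fun a b =>
    congrArg (fun f => Hom.lin f (a ⊗ₜ[ℂ] b)) hz2
  have h3 : ∀ a, (inner ℂ A.one a : ℂ) =
      LinearMap.trace ℂ A.carrier (bilin A.mul (z.lin (z.lin a))) := fun a => by
    rw [← mulTrace_lin]
    refine Eq.trans ?_ (congrArg (fun f => Hom.lin f a) hz).symm
    have h := LinearMap.adjoint_inner_right A.unit.lin (1 : ℂ) a
    refine h.symm.trans ?_
    change (inner ℂ (1 : ℂ) (_ : ℂ) : ℂ) = _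
    simp
    rfl
  have h4 : ∀ a b, bilin A.mul (bilin A.mul a b) = bilin A.mul a * bilin A.mul b := fun a b =>
    LinearMap.ext fun c => A.bilin_assoc a b c
  rw [h3, h3, ← h1, ← h1, ← h2, ← h2, h4, h4, LinearMap.trace_mul_comm]

theorem star_apply_eq_adjoint {T : A.carrier →L[ℂ] A.carrier}
    (hT : ∀ x y, T (bilin A.mul x y) = bilin A.mul (T x) y) (v : A.carrier) :
    star T v = LinearMap.adjoint (bilin A.mul (T A.one)) v := by
  refine ext_inner_left ℂ fun w => ?_
  rw [ContinuousLinearMap.star_eq_adjoint, ContinuousLinearMap.adjoint_inner_right,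
    LinearMap.adjoint_inner_right, ← hT, bilin_one_left]

/-- The C*-algebra of left multiplications, i.e. of operators commuting with all right
multiplications. -/
def leftMultiplications : StarSubalgebra ℂ (A.carrier →L[ℂ] A.carrier) where
  carrier := {T | ∀ x y, T (bilin A.mul x y) = bilin A.mul (T x) y}
  mul_mem' hS hT x y := by
    exact (congrArg _ (hT x y)).trans (hS (_) y)
  add_mem' hS hT x y := by simp [hS x y, hT x y]
  algebraMap_mem' r x y := by simp [Algebra.algebraMap_eq_smul_one]
  star_mem' {T} hT x y := by
    rw [star_apply_eq_adjoint A hT, star_apply_eq_adjoint A hT, adjoint_bilin_apply]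

/-- Closedness, automatic in finite dimension, is what makes this star-subalgebra a C*-algebra. -/
instance : IsClosed (A.leftMultiplications : Set (A.carrier →L[ℂ] A.carrier)) :=
  Submodule.closed_of_finiteDimensional
    (Subalgebra.toSubmodule A.leftMultiplications.toSubalgebra)

/-- The finite-dimensional C*-algebra underlying a normalisable dagger Frobenius algebra. -/
def toFdCStarAlg : FdCStarAlg where
  carrier := A.leftMultiplications
  finiteDimensional := inferInstanceAs
    (FiniteDimensional ℂ (Subalgebra.toSubmodule A.leftMultiplications.toSubalgebra))

/-- Elements of the underlying C*-algebra as operators. -/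
def op : A.toFdCStarAlg →⋆ₐ[ℂ] (A.carrier →L[ℂ] A.carrier) := A.leftMultiplications.subtype

theorem op_bilin (T : A.toFdCStarAlg) (x y : A.carrier) :
    A.op T (bilin A.mul x y) = bilin A.mul (A.op T x) y := T.2 x y

theorem op_apply_eq_bilin (T : A.toFdCStarAlg) (x : A.carrier) :
    A.op T x = bilin A.mul (A.op T A.one) x := by
  rw [← op_bilin, bilin_one_left]

/-- Evaluation at the unit element identifies the left multiplications with the algebra. -/
def equiv : A.toFdCStarAlg ≃ₗ[ℂ] A.carrier where
  toFun T := A.op T A.one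
  map_add' S T := by rw [map_add]; rfl
  map_smul' c T := by rw [map_smul]; rfl
  invFun a := (⟨LinearMap.toContinuousLinearMap (bilin A.mul a), fun x y =>
    (A.bilin_assoc a x y).symm⟩ : A.leftMultiplications)
  left_inv T := Subtype.ext (ContinuousLinearMap.ext fun x => (A.op_apply_eq_bilin T x).symm)
  right_inv a := A.bilin_one_right a

variable {A}

theorem op_apply (T : A.toFdCStarAlg) (x : A.carrier) :
    A.op T x = bilin A.mul (A.equiv T) x := A.op_apply_eq_bilin T x

theorem equiv_mul (S T : A.toFdCStarAlg) :
    A.equiv (S * T) = bilin A.mul (A.equiv S) (A.equiv T) := by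
  rw [← op_apply]
  exact congrArg (fun U : A.carrier →L[ℂ] A.carrier => U A.one) (map_mul A.op S T)

theorem equiv_star_mul (S T : A.toFdCStarAlg) :
    A.equiv (star S * T) = LinearMap.adjoint (bilin A.mul (A.equiv S)) (A.equiv T) := by
  rw [equiv_mul, ← op_apply, map_star]
  exact star_apply_eq_adjoint A S.2 _

variable (A) in
/-- The functional `⟪1, ·⟫`. -/
def functional : A.toFdCStarAlg →ₗ[ℂ] ℂ := innerₛₗ ℂ A.one ∘ₗ A.equiv.toLinearMap

theorem functional_apply (T : A.toFdCStarAlg) : A.functional T = inner ℂ A.one (A.equiv T) := rfl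

/-- The inner product of `A` is the GNS form of `⟪1, ·⟫`, whence positivity and faithfulness of that
functional. -/
theorem functional_star_mul (S T : A.toFdCStarAlg) :
    A.functional (star S * T) = inner ℂ (A.equiv S) (A.equiv T) := by
  rw [functional_apply, equiv_star_mul, LinearMap.adjoint_inner_right, bilin_one_right]

theorem functional_mul_comm (S T : A.toFdCStarAlg) :
    A.functional (S * T) = A.functional (T * S) := by
  rw [functional_apply, functional_apply, equiv_mul, equiv_mul, inner_one_bilin_comm]

theorem functional_star_mul_self_nonneg (T : A.toFdCStarAlg) :
    0 ≤ A.functional (star T * T) := by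
  rw [functional_star_mul, ← inner_self_ofReal_re]
  exact RCLike.ofReal_nonneg.2 (inner_self_nonneg (𝕜 := ℂ))

theorem eq_zero_of_functional_star_mul_self (T : A.toFdCStarAlg)
    (h : A.functional (star T * T) = 0) : T = 0 := by
  rwa [functional_star_mul, inner_self_eq_zero, LinearEquiv.map_eq_zero_iff] at h

/-- The linear map between C*-algebras of left multiplications induced by a linear map. -/
def leftMap (A B : NormalisableAlgebra FHilb) (φ : A.carrier →ₗ[ℂ] B.carrier) :
    A.toFdCStarAlg →ₗ[ℂ] B.toFdCStarAlg :=
  B.equiv.symm.toLinearMap ∘ₗ φ ∘ₗ A.equiv.toLinearMap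

variable {B : NormalisableAlgebra FHilb}

theorem equiv_leftMap (φ : A.carrier →ₗ[ℂ] B.carrier) (T : A.toFdCStarAlg) :
    B.equiv (leftMap A B φ T) = φ (A.equiv T) :=
  B.equiv.apply_symm_apply _

/-- The CP*-condition is complete positivity between the underlying C*-algebras. -/
theorem cpStarCondition_iff_isCompletelyPositive (f : A ⟶ B) :
    cpStarCondition FHilb f ↔
      IsCompletelyPositive (leftMap A B (show A.carrier ⟶ B.carrier from f).lin) := by
  rw [cpStarCondition_iff_forall_sum_nonneg, isCompletelyPositive_iff_forall_sum_nonneg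
    functional_star_mul_self_nonneg eq_zero_of_functional_star_mul_self]
  set φ := (show A.carrier ⟶ B.carrier from f).lin
  -- Traciality moves `y'` to the front, where it becomes the left vector `y'⋆` of the inner
  -- product; thus `xᵢ = yᵢ⋆` in the CP*-criterion.
  have key : ∀ (S S' : A.toFdCStarAlg) (y y' : B.toFdCStarAlg),
      B.functional (star y * leftMap A B φ (star S * S') * y') =
        inner ℂ (B.equiv (star y')) (bilin B.mul (B.equiv (star y))
          (φ (LinearMap.adjoint (bilin A.mul (A.equiv S)) (A.equiv S')))) := fun S S' y y' => by
    rw [functional_mul_comm]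
    conv_lhs => rw [← star_star y']
    rw [functional_star_mul, equiv_mul, equiv_leftMap, equiv_star_mul]
  refine ⟨fun h n a y => ?_, fun h n a x => ?_⟩
  · simp only [key]
    exact h n _ _
  · have h1 := h n (fun i => A.equiv.symm (a i)) fun i => star (B.equiv.symm (x i))
    simp only [key] at h1
    simpa only [star_star, LinearEquiv.apply_symm_apply] using h1

end CPStarConstruction.NormalisableAlgebra

/-! ### The trace of the regular representation. -/

section TraceForm

open ComplexOrder

variable {B : Type*} [CStarAlgebra B]

variable (B) in
/-- The trace of the left regular representation. -/
def regularTrace : B →ₗ[ℂ] ℂ := LinearMap.trace ℂ B ∘ₗ (Algebra.lmul ℂ B).toLinearMap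

theorem regularTrace_apply (a : B) :
    regularTrace B a = LinearMap.trace ℂ B (Algebra.lmul ℂ B a) := rfl

theorem regularTrace_mul_comm (a b : B) :
    regularTrace B (a * b) = regularTrace B (b * a) := by
  rw [regularTrace_apply, regularTrace_apply, map_mul (Algebra.lmul ℂ B),
    map_mul (Algebra.lmul ℂ B), LinearMap.trace_mul_comm]

variable [FiniteDimensional ℂ B]

/-- Eigenvalues of left multiplication by `a⋆ a` lie in the spectrum of `a⋆ a`, since algebra
homomorphisms do not enlarge spectra. -/
theorem nonneg_of_mem_roots_charpoly_lmul (a : B) {z : ℂ}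
    (hz : z ∈ (Algebra.lmul ℂ B (star a * a)).charpoly.roots) : 0 ≤ z := by
  let _ : PartialOrder B := CStarAlgebra.spectralOrder B
  let _ : StarOrderedRing B := CStarAlgebra.spectralOrderedRing B
  have h1 := (Module.End.mem_spectrum_iff_isRoot_charpoly _ _).2 (Polynomial.isRoot_of_mem_roots hz)
  exact spectrum_nonneg_of_nonneg (star_mul_self_nonneg a) (AlgHom.spectrum_apply_subset _ _ h1)

theorem trace_star_mul_self_eq (a : B) : regularTrace B (star a * a) =
    (Algebra.lmul ℂ B (star a * a)).charpoly.roots.sum :=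
  Module.End.trace_eq_sum_roots_charpoly_of_splits (IsAlgClosed.splits _)

/-- The trace of the regular representation of a finite-dimensional C*-algebra is positive. -/
theorem trace_star_mul_self_nonneg (a : B) : 0 ≤ regularTrace B (star a * a) := by
  rw [trace_star_mul_self_eq]
  exact Multiset.sum_nonneg fun z hz => nonneg_of_mem_roots_charpoly_lmul a hz

/-- The trace of the regular representation of a finite-dimensional C*-algebra is faithful. -/
theorem eq_zero_of_trace_star_mul_self (a : B) (h : regularTrace B (star a * a) = 0) :
    a = 0 := by
  set f := Algebra.lmul ℂ B (star a * a) with hf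
  have h1 : ∀ z ∈ f.charpoly.roots, z = 0 := by
    rw [trace_star_mul_self_eq] at h
    exact Multiset.all_zero_of_le_zero_le_of_sum_eq_zero
      (fun z hz => nonneg_of_mem_roots_charpoly_lmul a hz) h
  -- Nonnegative eigenvalues with zero sum all vanish, so by Cayley–Hamilton `a⋆ a` is nilpotent.
  have h2 : f.charpoly = Polynomial.X ^ Module.finrank ℂ B := by
    have h3 := (IsAlgClosed.splits f.charpoly).eq_prod_roots_of_monic f.charpoly_monic
    rw [Multiset.eq_replicate_card.2 h1] at h3
    rw [← f.charpoly_natDegree, (IsAlgClosed.splits f.charpoly).natDegree_eq_card_roots]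
    simpa using h3
  have h3 : (star a * a) ^ Module.finrank ℂ B = 0 := by
    have h4 := f.aeval_self_charpoly
    rw [h2, map_pow, Polynomial.aeval_X, hf, ← map_pow] at h4
    simpa using LinearMap.congr_fun h4 1
  -- A self-adjoint nilpotent vanishes: the C*-norm is multiplicative on its powers of exponent `2 ^
  -- n`, and `2 ^ n` exceeds the nilpotency exponent `n`.
  have h4 := (IsSelfAdjoint.star_mul_self a).norm_pow_two_pow (Module.finrank ℂ B)
  rw [pow_eq_zero_of_le Nat.lt_two_pow_self.le h3, norm_zero, eq_comm, pow_eq_zero_iff (by positivity),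
    norm_eq_zero, CStarRing.star_mul_self_eq_zero_iff] at h4
  exact h4

end TraceForm

/-! ### From C*-algebras to Frobenius algebras. -/

namespace FdCStarAlg

variable (B : FdCStarAlg)

/-- The vector space underlying a C*-algebra, to be equipped with the trace inner product. -/
def TraceSpace (B : FdCStarAlg) : Type := B.carrier

instance : AddCommGroup B.TraceSpace := inferInstanceAs (AddCommGroup B.carrier)

instance : Module ℂ B.TraceSpace := inferInstanceAs (Module ℂ B.carrier)

/-- The tautological identification. -/
def toTrace : B.carrier ≃ₗ[ℂ] B.TraceSpace := LinearEquiv.refl ℂ B.carrier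

/-- The inner product `⟪a, b⟫ = Tr (a⋆ b)`. -/
abbrev traceCore : InnerProductSpace.Core ℂ B.TraceSpace where
  inner a b := regularTrace B (star (B.toTrace.symm a) * B.toTrace.symm b)
  conj_inner_symm a b := by
    rw [starRingEnd_apply, ← map_star_of_forall_nonneg trace_star_mul_self_nonneg]
    simp
  re_inner_nonneg a := (Complex.nonneg_iff.1 (trace_star_mul_self_nonneg (B.toTrace.symm a))).1
  add_left a b c := by simp [add_mul]
  smul_left a b r := by simp
  definite a h := by simpa using eq_zero_of_trace_star_mul_self _ h

instance : NormedAddCommGroup B.TraceSpace :=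
  @InnerProductSpace.Core.toNormedAddCommGroup ℂ _ _ _ _ B.traceCore

instance : InnerProductSpace ℂ B.TraceSpace := InnerProductSpace.ofCore B.traceCore.toCore

instance : FiniteDimensional ℂ B.TraceSpace := B.toTrace.finiteDimensional

theorem inner_toTrace (a b : B) :
    (inner ℂ (B.toTrace a) (B.toTrace b) : ℂ) = regularTrace B (star a * b) := rfl

/-- The Hilbert space underlying a finite-dimensional C*-algebra. -/
def traceHilb : FHilb := ⟨B.TraceSpace⟩

/-- The multiplication as a morphism of Hilbert spaces. -/
def traceMul : B.traceHilb ⊗ B.traceHilb ⟶ B.traceHilb :=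
  ⟨B.toTrace.toLinearMap ∘ₗ LinearMap.mul' ℂ B ∘ₗ
    TensorProduct.map B.toTrace.symm.toLinearMap B.toTrace.symm.toLinearMap⟩

end FdCStarAlg

namespace FHilb

variable {H : FHilb} (m : H ⊗ H ⟶ H)

/-- An associative multiplication whose left multiplications are closed under adjoints satisfies
one half of the Frobenius law. -/
theorem frobenius_left_of_adjoint (hm : ∀ a b c, bilin m (bilin m a b) c = bilin m a (bilin m b c))
    (s : H → H) (hs : ∀ a x y, (inner ℂ (bilin m a x) y : ℂ) = inner ℂ x (bilin m (s a) y)) :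
    H ◁ dagger m ≫ (α_ H H H).inv ≫ m ▷ H = m ≫ dagger m := by
  have hs' : ∀ a x y, (inner ℂ x (bilin m a y) : ℂ) = inner ℂ (bilin m (s a) x) y := fun a x y => by
    rw [← inner_conj_symm, hs, inner_conj_symm]
  refine hom_ext (TensorProduct.ext' fun a b => ?_)
  change TensorProduct.map m.lin LinearMap.id ((TensorProduct.assoc ℂ H H H).symm
    (a ⊗ₜ[ℂ] (dagger m).lin b)) = (dagger m).lin (bilin m a b)
  refine TensorProduct.ext_iff_inner_left.2 fun x y => ?_
  have h1 : ∀ t : H ⊗[ℂ] H, (inner ℂ (x ⊗ₜ[ℂ] y) (TensorProduct.map m.lin LinearMap.id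
      ((TensorProduct.assoc ℂ H H H).symm (a ⊗ₜ[ℂ] t))) : ℂ) =
      inner ℂ (bilin m (s a) x ⊗ₜ[ℂ] y) t := fun t => by
    induction t with
    | zero => simp
    | tmul p q =>
      rw [TensorProduct.assoc_symm_tmul, TensorProduct.map_tmul, lin_tmul]
      refine (TensorProduct.inner_tmul ℂ _ _ _ _).trans ?_
      rw [TensorProduct.inner_tmul, hs', LinearMap.id_apply]
    | add t u ht hu =>
      rw [TensorProduct.tmul_add, map_add, map_add, inner_add_right, inner_add_right, ← ht, ← hu]
  -- Tested on `x ⊗ y`, the two sides are `⟪((s a) x) y, b⟫` and `⟪x y, a b⟫`, equal by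
  -- associativity and the adjoint relation.
  refine (h1 _).trans ?_
  refine (LinearMap.adjoint_inner_right m.lin (bilin m (s a) x ⊗ₜ[ℂ] y) b).trans ?_
  refine Eq.trans ?_ (LinearMap.adjoint_inner_right m.lin (x ⊗ₜ[ℂ] y) (bilin m a b)).symm
  rw [lin_tmul, lin_tmul, hm, hs']

/-- An associative multiplication whose right multiplications are closed under adjoints satisfies
the other half of the Frobenius law. -/
theorem frobenius_right_of_adjoint
    (hm : ∀ a b c, bilin m (bilin m a b) c = bilin m a (bilin m b c))
    (s : H → H) (hs : ∀ a x y, (inner ℂ (bilin m x a) y : ℂ) = inner ℂ x (bilin m y (s a))) :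
    dagger m ▷ H ≫ (α_ H H H).hom ≫ H ◁ m = m ≫ dagger m := by
  have hs' : ∀ a x y, (inner ℂ x (bilin m y a) : ℂ) = inner ℂ (bilin m x (s a)) y := fun a x y => by
    rw [← inner_conj_symm, hs, inner_conj_symm]
  refine hom_ext (TensorProduct.ext' fun a b => ?_)
  change TensorProduct.map LinearMap.id m.lin (TensorProduct.assoc ℂ H H H
    ((dagger m).lin a ⊗ₜ[ℂ] b)) = (dagger m).lin (bilin m a b)
  refine TensorProduct.ext_iff_inner_left.2 fun x y => ?_
  have h1 : ∀ t : H ⊗[ℂ] H, (inner ℂ (x ⊗ₜ[ℂ] y) (TensorProduct.map LinearMap.id m.lin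
      (TensorProduct.assoc ℂ H H H (t ⊗ₜ[ℂ] b))) : ℂ) =
      inner ℂ (x ⊗ₜ[ℂ] bilin m y (s b)) t := fun t => by
    induction t with
    | zero => simp
    | tmul p q =>
      rw [TensorProduct.assoc_tmul, TensorProduct.map_tmul, lin_tmul]
      refine (TensorProduct.inner_tmul ℂ _ _ _ _).trans ?_
      rw [TensorProduct.inner_tmul, hs', LinearMap.id_apply]
    | add t u ht hu =>
      rw [TensorProduct.add_tmul, map_add, map_add, inner_add_right (𝕜 := ℂ) (_ ⊗ₜ[ℂ] _) t u, ← ht, ← hu]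
      exact inner_add_right (𝕜 := ℂ) (x ⊗ₜ[ℂ] y) _ _
  refine (h1 _).trans ?_
  refine (LinearMap.adjoint_inner_right m.lin (x ⊗ₜ[ℂ] bilin m y (s b)) a).trans ?_
  refine Eq.trans ?_ (LinearMap.adjoint_inner_right m.lin (x ⊗ₜ[ℂ] y) (bilin m a b)).symm
  rw [lin_tmul, lin_tmul, ← hm, hs']

end FHilb

namespace FdCStarAlg

open FHilb CPStarConstruction

variable (B : FdCStarAlg)

theorem bilin_traceMul_assoc (a b c : B.traceHilb) :
    bilin B.traceMul (bilin B.traceMul a b) c = bilin B.traceMul a (bilin B.traceMul b c) :=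
  mul_assoc (B.toTrace.symm a) (B.toTrace.symm b) (B.toTrace.symm c)

/-- The unit as a morphism of Hilbert spaces. -/
def traceUnit : 𝟙_ FHilb ⟶ B.traceHilb := ⟨LinearMap.toSpanSingleton ℂ _ (B.toTrace 1)⟩

/-- The involution on the Hilbert space of a C*-algebra. -/
def traceStar (a : B.traceHilb) : B.traceHilb := B.toTrace (star (B.toTrace.symm a))

theorem inner_traceMul_left (a x y : B.traceHilb) :
    (inner ℂ (bilin B.traceMul a x) y : ℂ) =
      inner ℂ x (bilin B.traceMul (B.traceStar a) y) := by
  change regularTrace B (star (B.toTrace.symm a * B.toTrace.symm x) * B.toTrace.symm y) =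
    regularTrace B (star (B.toTrace.symm x) * (star (B.toTrace.symm a) * B.toTrace.symm y))
  rw [star_mul, mul_assoc]

/-- Unlike its left-handed counterpart, this needs the trace property. -/
theorem inner_traceMul_right (a x y : B.traceHilb) :
    (inner ℂ (bilin B.traceMul x a) y : ℂ) =
      inner ℂ x (bilin B.traceMul y (B.traceStar a)) := by
  change regularTrace B (star (B.toTrace.symm x * B.toTrace.symm a) * B.toTrace.symm y) =
    regularTrace B (star (B.toTrace.symm x) * (B.toTrace.symm y * star (B.toTrace.symm a)))
  rw [star_mul, mul_assoc, regularTrace_mul_comm, mul_assoc]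

/-- Both sides are `a ↦ Tr L_a`, because `⟪1, a⟫` is by construction the regular trace; hence `z =
1` normalises. -/
theorem mulTrace_traceMul : mulTrace B.traceMul = dagger B.traceUnit := by
  refine hom_ext (LinearMap.ext fun a => ?_)
  rw [mulTrace_lin]
  have h1 : (inner ℂ (1 : ℂ) ((dagger B.traceUnit).lin a : ℂ) : ℂ) =
      inner ℂ (B.traceUnit.lin (1 : ℂ)) a := LinearMap.adjoint_inner_right _ _ _
  have h2 : B.traceUnit.lin (1 : ℂ) = B.toTrace 1 := one_smul ℂ _
  have h3 : (inner ℂ (B.toTrace 1) (B.toTrace (B.toTrace.symm a)) : ℂ) =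
      regularTrace B (B.toTrace.symm a) := by rw [inner_toTrace, star_one, one_mul]
  have h4 : (inner ℂ (1 : ℂ) ((dagger B.traceUnit).lin a : ℂ) : ℂ) =
      (dagger B.traceUnit).lin a := by
    refine (RCLike.inner_apply _ _).trans ?_
    rw [map_one]
    exact mul_one _
  rw [← h4, h1, h2]
  exact h3.symm

/-- A finite-dimensional C*-algebra as a normalisable dagger Frobenius algebra. -/
def toNormalisableAlgebra : NormalisableAlgebra FHilb where
  carrier := B.traceHilb
  mul := B.traceMul
  unit := B.traceUnit
  mul_assoc := hom_ext (TensorProduct.ext_threefold fun a b c => B.bilin_traceMul_assoc a b c)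
  unit_mul := hom_ext (TensorProduct.ext' fun c a => by
    change B.toTrace (((show ℂ from c) • (1 : B)) * B.toTrace.symm a) =
      B.toTrace ((show ℂ from c) • B.toTrace.symm a)
    rw [smul_mul_assoc, one_mul])
  mul_unit := hom_ext (TensorProduct.ext' fun a c => by
    change B.toTrace (B.toTrace.symm a * (show ℂ from c) • (1 : B)) =
      B.toTrace ((show ℂ from c) • B.toTrace.symm a)
    rw [mul_smul_comm, mul_one])
  frobenius_left := frobenius_left_of_adjoint _ B.bilin_traceMul_assoc _ B.inner_traceMul_left
  frobenius_right := frobenius_right_of_adjoint _ B.bilin_traceMul_assoc _ B.inner_traceMul_right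
  normalisable := ⟨𝟙 _, ⟨by simp, by simp⟩,
    ⟨⟨_, 𝟙 _, by rw [dagger_id, Category.comp_id]⟩, inferInstance⟩, by
      rw [Category.id_comp, Category.id_comp, mulTrace_traceMul]⟩

end FdCStarAlg

/-- Applying `f` entrywise sends `M⋆ M` to `(f M)⋆ (f M)`. -/
theorem isCompletelyPositive_of_map_star_mul {A B : Type*} [CStarAlgebra A] [CStarAlgebra B]
    (f : A →ₗ[ℂ] B) (hf : ∀ a b, f (star a * b) = star (f a) * f b) : IsCompletelyPositive f := by
  refine (isCompletelyPositive_iff_matrix f).2 fun n M => ⟨M.map f, ?_⟩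
  ext i j
  simp [Matrix.mul_apply, Matrix.star_apply, hf]

namespace FdCStarAlg

/-- A linear bijection compatible with `a⋆ b` is an isomorphism for completely positive maps. -/
def isoOfMapStarMul {A B : FdCStarAlg} (e : A ≃ₗ[ℂ] B)
    (he : ∀ a b, e (star a * b) = star (e a) * e b) : A ≅ B where
  hom := ⟨e.toLinearMap, isCompletelyPositive_of_map_star_mul _ he⟩
  inv := ⟨e.symm.toLinearMap, isCompletelyPositive_of_map_star_mul _ fun a b =>
    e.injective (by simp [he])⟩
  hom_inv_id := Hom.ext (LinearMap.ext fun a => e.symm_apply_apply a)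
  inv_hom_id := Hom.ext (LinearMap.ext fun b => e.apply_symm_apply b)

end FdCStarAlg

/-! ### The equivalence of categories. -/

namespace CPStarConstruction

open NormalisableAlgebra

theorem leftMap_id (A : NormalisableAlgebra FHilb) : leftMap A A LinearMap.id = LinearMap.id :=
  LinearMap.ext fun T => A.equiv.symm_apply_apply T

theorem leftMap_comp {A B C : NormalisableAlgebra FHilb} (φ : A.carrier →ₗ[ℂ] B.carrier)
    (ψ : B.carrier →ₗ[ℂ] C.carrier) :
    leftMap A C (ψ ∘ₗ φ) = leftMap B C ψ ∘ₗ leftMap A B φ :=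
  LinearMap.ext fun T => C.equiv.injective (by
    rw [LinearMap.comp_apply, equiv_leftMap, equiv_leftMap, equiv_leftMap, LinearMap.comp_apply])

/-- Identities and composites are inherited from completely positive maps, so Kraus maps never have
to be composed. -/
instance : (cpStarCondition FHilb).IsMultiplicative where
  id_mem A := (cpStarCondition_iff_isCompletelyPositive _).2 (by
    have h := FdCStarAlg.Hom.completelyPositive (𝟙 A.toFdCStarAlg)
    rwa [show FdCStarAlg.Hom.lin (𝟙 A.toFdCStarAlg) = _ from (leftMap_id A).symm] at h)
  comp_mem {A B C} f g hf hg := (cpStarCondition_iff_isCompletelyPositive _).2 (by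
    let F : A.toFdCStarAlg ⟶ B.toFdCStarAlg := ⟨_, (cpStarCondition_iff_isCompletelyPositive f).1 hf⟩
    let G : B.toFdCStarAlg ⟶ C.toFdCStarAlg := ⟨_, (cpStarCondition_iff_isCompletelyPositive g).1 hg⟩
    have h := FdCStarAlg.Hom.completelyPositive (F ≫ G)
    rwa [show FdCStarAlg.Hom.lin (F ≫ G) = _ from (leftMap_comp _ _).symm] at h)

/-- The functor sending a normalisable dagger Frobenius algebra to its C*-algebra of left
multiplications. -/
def toFdCStarAlgFunctor : CPStar FHilb ⥤ FdCStarAlg where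
  obj A := A.obj.toFdCStarAlg
  map f := ⟨_, (cpStarCondition_iff_isCompletelyPositive f.hom).1 f.property⟩
  map_id A := FdCStarAlg.Hom.ext (leftMap_id A.obj)
  map_comp _ _ := FdCStarAlg.Hom.ext (leftMap_comp _ _)

theorem leftMap_equiv_conj {A B : NormalisableAlgebra FHilb}
    (F : A.toFdCStarAlg →ₗ[ℂ] B.toFdCStarAlg) :
    leftMap A B (B.equiv.toLinearMap ∘ₗ F ∘ₗ A.equiv.symm.toLinearMap) = F :=
  LinearMap.ext fun T => B.equiv.injective (by simp [equiv_leftMap])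

theorem leftMap_injective {A B : NormalisableAlgebra FHilb} :
    Function.Injective (leftMap A B) := fun φ ψ h => LinearMap.ext fun a => by
  rw [← A.equiv.apply_symm_apply a, ← equiv_leftMap, h, equiv_leftMap]

instance : toFdCStarAlgFunctor.Faithful where
  map_injective {_ _} _ _ h := WideSubcategory.hom_ext _
    (FHilb.hom_ext (leftMap_injective (congrArg FdCStarAlg.Hom.lin h)))

instance : toFdCStarAlgFunctor.Full where
  map_surjective {A B} F := by
    let f : A.obj ⟶ B.obj := (⟨B.obj.equiv.toLinearMap ∘ₗ F.lin ∘ₗ A.obj.equiv.symm.toLinearMap⟩ :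
      FHilb.Hom A.obj.carrier B.obj.carrier)
    have hf := leftMap_equiv_conj F.lin
    exact ⟨⟨f, (cpStarCondition_iff_isCompletelyPositive f).2
      (hf.symm ▸ F.completelyPositive)⟩, FdCStarAlg.Hom.ext hf⟩

instance : toFdCStarAlgFunctor.EssSurj where
  mem_essImage B := ⟨⟨B.toNormalisableAlgebra⟩, ⟨FdCStarAlg.isoOfMapStarMul
    (B.toNormalisableAlgebra.equiv ≪≫ₗ B.toTrace.symm) fun S T => by
      -- For the trace inner product the adjoint of `L_x` is `L_(x⋆)`, so the operator involution
      -- agrees with the original one.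
      have h : ∀ x y, LinearMap.adjoint (FHilb.bilin B.traceMul x) y =
          FHilb.bilin B.traceMul (B.traceStar x) y := fun x y => by
        refine ext_inner_left ℂ fun w => ?_
        rw [LinearMap.adjoint_inner_right, B.inner_traceMul_left]
      refine (congrArg B.toTrace.symm ((equiv_star_mul S T).trans (h _ _))).trans ?_
      rfl⟩⟩

instance : toFdCStarAlgFunctor.IsEquivalence where

end CPStarConstruction

theorem mainTheorem4 :
    ∃ _ : (CPStarConstruction.cpStarCondition FHilb).IsMultiplicative,
      Nonempty (CPStarConstruction.CPStar FHilb ≌ FdCStarAlg) :=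
  ⟨inferInstance, ⟨CPStarConstruction.toFdCStarAlgFunctor.asEquivalence⟩⟩

end
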